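/- Let $B$ be the unit ball of $\mathbb{R}^3$ with boundary $\partial B=\mathbb{S}^2$, and let $k\in\mathbb{C}\setminus\{0\}$ (in particular, any frequency $k>0$). Let $G_k(\mathbf{x})=-\frac{e^{ik|\mathbf{x}|}}{4\pi|\mathbf{x}|}$, and define the Neumann–Poincaré operator by $$(\mathcal{K}_B^k)^*[\phi](\mathbf{x})=\mathrm{p.v.}\int_{\partial B}\frac{\partial G_k(\mathbf{x}-\mathbf{y})}{\partial\nu(\mathbf{x})}\,\phi(\mathbf{y})\,ds_{\mathbf{y}}=\lim_{\varepsilon\to0^+}\int_{\{\mathbf{y}\in\partial B:\,|\mathbf{x}-\mathbf{y}|>\varepsilon\}}\frac{\partial G_k(\mathbf{x}-\mathbf{y})}{\partial\nu(\mathbf{x})}\,\phi(\mathbf{y})\,ds_{\mathbf{y}},\qquad \mathbf{x}\in\partial B,$$ where $\nu(\mathbf{x})=\mathbf{x}$ is the exterior unit normal and the derivative is taken in $\mathbf{x}$. For $n=0,1,2,\dots$ let $$j_n(t)=\sum_{l=0}^\infty\frac{(-1)^l\,t^{2l+n}}{2^l\,l!\,1\cdot3\cdots(2n+2l+1)},\qquad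 y_n(t)=-\frac{(2n)!}{2^n n!}\sum_{l=0}^\infty\frac{(-1)^l\,t^{2l-n-1}}{2^l\,l!\,(-2n+1)(-2n+3)\cdots(-2n+2l-1)},$$ and $h_n^{(1)}=j_n+i\,y_n$. For $-n\le m\le n$ let $Y_n^m$ be the spherical harmonic $$Y_n^m(\theta,\varphi)=\sqrt{\frac{2n+1}{4\pi}\,\frac{(n-|m|)!}{(n+|m|)!}}\;P_n^{|m|}(\cos\theta)\,e^{im\varphi},\qquad P_n^{|m|}(\cos\theta)=(\sin\theta)^{|m|}\,P_n^{(|m|)}(\cos\theta),$$ where $(\theta,\varphi)$ are the spherical coordinates on $\mathbb{S}^2$ and $P_n^{(|m|)}$ is the derivative of order $|m|$ of the Legendre polynomial $P_n$. Then the principal value $(\mathcal{K}_B^k)^*[Y_n^m](\mathbf{x})$ exists at every $\mathbf{x}\in\partial B$, and on $\partial B$ $$(\mathcal{K}_B^k)^*[Y_n^m]=\Big(-\frac12-ik^2j_n(k)\,{h_n^{(1)}}'(k)\Big)Y_n^m=\Big(\frac12-ik^2j_n'(k)\,h_n^{(1)}(k)\Big)Y_n^m .$$ -/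

import Mathlib

open MeasureTheory Metric Filter Topology
open scoped Nat

noncomputable section

/-- Three-dimensional Euclidean space. -/
abbrev Space3 : Type := EuclideanSpace ℝ (Fin 3)

/-- The boundary of the unit ball `B`, i.e. the unit sphere of `ℝ³`. Its surface measure is
`(volume : Measure Space3).toSphere`, of total mass `4π`. -/
abbrev UnitSphere : Type := sphere (0 : Space3) 1

/-- The outgoing fundamental solution of `Δ + k²` in `ℝ³`, `G_k(z) = -e^{ik|z|} / (4π|z|)`. -/
def helmholtzG (k : ℂ) (z : Space3) : ℂ :=
  -Complex.exp (Complex.I * k * (‖z‖ : ℂ)) / (4 * (Real.pi : ℂ) * (‖z‖ : ℂ))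

/-- The normal derivative `∂ G_k(x - y) / ∂ν(x)`: the derivative in the variable `x`, in the
direction of the exterior unit normal of the unit ball at `x`, which is `ν(x) = x`. -/
def helmholtzGNormalDeriv (k : ℂ) (x y : UnitSphere) : ℂ :=
  fderiv ℝ (fun z : Space3 => helmholtzG k (z - (y : Space3))) (x : Space3) (x : Space3)

/-- The part of the sphere at distance more than `ε` from `x`. -/
def awayFrom (x : UnitSphere) (ε : ℝ) : Set UnitSphere :=
  {y | ε < dist y x}

/-- The integral `∫_{y ∈ ∂B, |x - y| > ε} (∂ G_k(x - y) / ∂ν(x)) f(y) ds_y`. -/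
def npTruncated (k : ℂ) (f : UnitSphere → ℂ) (x : UnitSphere) (ε : ℝ) : ℂ :=
  ∫ y in awayFrom x ε, helmholtzGNormalDeriv k x y * f y ∂((volume : Measure Space3).toSphere)

/-- The principal value integral that defines `(K_B^k)^*[f](x)` exists and equals `v`. -/
def HasNPValue (k : ℂ) (f : UnitSphere → ℂ) (x : UnitSphere) (v : ℂ) : Prop :=
  (∀ ε : ℝ, 0 < ε →
    IntegrableOn (fun y => helmholtzGNormalDeriv k x y * f y) (awayFrom x ε)
      ((volume : Measure Space3).toSphere)) ∧
  Tendsto (npTruncated k f x) (𝓝[>] (0 : ℝ)) (𝓝 v)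

/-- The Neumann–Poincaré operator `(K_B^k)^*` of the unit ball,
`(K_B^k)^*[f](x) = p.v. ∫_{∂B} (∂ G_k(x - y) / ∂ν(x)) f(y) ds_y`. -/
def neumannPoincare (k : ℂ) (f : UnitSphere → ℂ) (x : UnitSphere) : ℂ :=
  limUnder (𝓝[>] (0 : ℝ)) (npTruncated k f x)

/-- The spherical Bessel function
`j_n(t) = ∑_l (-1)^l t^(2l+n) / (2^l l! · 1·3⋯(2n+2l+1))`. -/
def sphericalBesselJ (n : ℕ) (t : ℂ) : ℂ :=
  ∑' l : ℕ, (-1) ^ l * t ^ (2 * l + n) /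
    (2 ^ l * (l ! : ℂ) * ((2 * n + 2 * l + 1)‼ : ℂ))

/-- The spherical Neumann function
`y_n(t) = -((2n)! / (2^n n!)) ∑_l (-1)^l t^(2l-n-1) / (2^l l! (-2n+1)(-2n+3)⋯(-2n+2l-1))`. -/
def sphericalNeumannY (n : ℕ) (t : ℂ) : ℂ :=
  -(((2 * n)! : ℂ) / (2 ^ n * (n ! : ℂ))) *
    ∑' l : ℕ, (-1) ^ l * t ^ (2 * (l : ℤ) - n - 1) /
      (2 ^ l * (l ! : ℂ) * ∏ i ∈ Finset.range l, (-2 * (n : ℂ) + 2 * (i : ℂ) + 1))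

/-- The spherical Hankel function of the first kind, `h_n^{(1)} = j_n + i y_n`. -/
def sphericalHankelH1 (n : ℕ) (t : ℂ) : ℂ :=
  sphericalBesselJ n t + Complex.I * sphericalNeumannY n t

/-- The Legendre polynomial `P_n(t) = (1 / (2^n n!)) dⁿ/dtⁿ (t² - 1)ⁿ`. -/
def legendreP (n : ℕ) : Polynomial ℝ :=
  Polynomial.C (1 / (2 ^ n * (n ! : ℝ))) *
    Polynomial.derivative^[n] ((Polynomial.X ^ 2 - 1) ^ n)

/-- The factor `(sin θ)^{|m|} e^{imφ}` in Cartesian coordinates: at the point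
`x = (sin θ cos φ, sin θ sin φ, cos θ)` it is `(x₀ + i x₁)^m` for `m ≥ 0` and
`(x₀ - i x₁)^{|m|}` for `m < 0`. -/
def azimuthalFactor (m : ℤ) (x : Space3) : ℂ :=
  if 0 ≤ m then ((x 0 : ℂ) + Complex.I * (x 1 : ℂ)) ^ m.natAbs
  else ((x 0 : ℂ) - Complex.I * (x 1 : ℂ)) ^ m.natAbs

/-- The spherical harmonic `Y_n^m`, `-n ≤ m ≤ n`,
`Y_n^m = √((2n+1)/(4π) · (n-|m|)!/(n+|m|)!) P_n^{|m|}(cos θ) e^{imφ}`, where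
`P_n^{|m|}(cos θ) = (sin θ)^{|m|} (d^{|m|} P_n / dt^{|m|})(cos θ)` is the associated Legendre
function and `x = (sin θ cos φ, sin θ sin φ, cos θ)`. -/
def sphericalHarmonicY (n : ℕ) (m : ℤ) (x : UnitSphere) : ℂ :=
  ((Real.sqrt ((2 * (n : ℝ) + 1) / (4 * Real.pi) *
      (((n - m.natAbs)! : ℝ) / ((n + m.natAbs)! : ℝ))) : ℝ) : ℂ) *
    (((Polynomial.derivative^[m.natAbs] (legendreP n)).eval ((x : Space3) 2) : ℝ) : ℂ) *
    azimuthalFactor m (x : Space3)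

end

/-! On the unit sphere, with r = |x - y| and t = ⟨x, y⟩ = 1 - r²/2, one has ⟨x - y, x⟩ = r²/2. The
normal derivative of G_k therefore equals (1/8π)(1/r - ik)e^{ikr}: it depends only on t and has the
weak singularity 1/r. So the principal value is an absolutely convergent integral, and a zonal
kernel acts on degree-n harmonics as the scalar 2π ∫ K(t) P_n(t) dt
(`funkHecke_sphericalHarmonicY`).

Funk–Hecke is proved for powers of isotropic linear forms, which generate the spherical harmonics.
At the pole, rotation about the axis kills every angular frequency except the zonal one, and
Archimedes' hat-box theorem reduces the rest to an integral over [-1, 1]. Comparing coefficients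
along a curve of isotropic vectors then gives each Y_n^m.

The substitution t = 1 - r²/2 turns the scalar into (I_n - k I_n')/4, where I_n(k) = ∫₀² e^{ikr}
P_n(1 - r²/2) dr. The key identity is I_n = 2ik j_n h_n (`radialIntegral_eq`), by induction on n:
both sides obey the same first-order recurrence, and the difference is entire, which rules out the
homogeneous solution k^{-(2n+3)}. The scalar is thus -(i/2)k²(j_n h_n)', and the Wronskian k²(j_n
h_n' - j_n' h_n) = i (`besselA_mul_besselH_succ_sub`) rewrites it in the two stated forms. -/

/-! ### Recurrences for Legendre polynomials from Rodrigues' formula -/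

open Polynomial in
-- One differentiation produces the factor X, after which Leibniz has only two terms. The truncated
-- j - 1 at j = 0 is harmless because of the factor j.
theorem iterate_derivative_succ_sq_sub_one_pow (n j : ℕ) :
    derivative^[j + 1] (((X : ℝ[X]) ^ 2 - 1) ^ (n + 1)) =
      C (2 * ((n : ℝ) + 1)) * (derivative^[j] (((X : ℝ[X]) ^ 2 - 1) ^ n) * X +
        (j : ℝ[X]) * derivative^[j - 1] (((X : ℝ[X]) ^ 2 - 1) ^ n)) := by
  rw [Function.iterate_succ_apply, derivative_pow_succ]
  have : C ((n : ℝ) + 1) * ((X : ℝ[X]) ^ 2 - 1) ^ n * derivative ((X : ℝ[X]) ^ 2 - 1) =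
      C (2 * ((n : ℝ) + 1)) * (((X : ℝ[X]) ^ 2 - 1) ^ n * X) := by
    have h2 : (C 2 : ℝ[X]) = 2 := rfl
    simp [h2]; ring
  rw [this, iterate_derivative_C_mul, iterate_derivative_mul_X, nsmul_eq_mul]

open Polynomial in
theorem derivative_legendreP_succ (n : ℕ) :
    derivative (legendreP (n + 1)) =
      X * derivative (legendreP n) + C ((n : ℝ) + 1) * legendreP n := by
  unfold legendreP
  have h := iterate_derivative_succ_sq_sub_one_pow n (n + 1)
  simp only [Nat.add_sub_cancel] at h
  rw [derivative_C_mul, derivative_C_mul, ← Function.iterate_succ_apply' derivative,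
    ← Function.iterate_succ_apply' derivative, h]
  have hc : (1 / (2 ^ (n + 1) * ((n + 1)! : ℝ))) * (2 * ((n : ℝ) + 1)) = 1 / (2 ^ n * (n ! : ℝ)) := by
    rw [Nat.factorial_succ]; push_cast; field_simp; ring
  rw [← mul_assoc, ← C_mul, hc]
  simp
  ring

open Polynomial in
-- Two Leibniz expansions of the same derivative are compared: one after differentiating the power
-- once (`h1`), one from the factorisation (X² - 1)(X² - 1)^n (`h2`). The combination 2·`h2` - `h1`
-- removes the derivative of order n - 1.
theorem succ_mul_legendreP_succ (n : ℕ) :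
    C ((n : ℝ) + 1) * legendreP (n + 1) =
      (X ^ 2 - 1) * derivative (legendreP n) + C ((n : ℝ) + 1) * (X * legendreP n) := by
  have h1 := iterate_derivative_succ_sq_sub_one_pow n n
  have h2 : derivative^[n + 1] (((X : ℝ[X]) ^ 2 - 1) ^ (n + 1)) =
      (X ^ 2 - 1) * derivative^[n + 1] (((X : ℝ[X]) ^ 2 - 1) ^ n) +
      2 * ((n : ℝ[X]) + 1) * X * derivative^[n] (((X : ℝ[X]) ^ 2 - 1) ^ n) +
      ((n : ℝ[X]) + 1) * (n : ℝ[X]) * derivative^[n - 1] (((X : ℝ[X]) ^ 2 - 1) ^ n) := by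
    have : ((X : ℝ[X]) ^ 2 - 1) ^ (n + 1) =
      (((X : ℝ[X]) ^ 2 - 1) ^ n * X) * X - ((X : ℝ[X]) ^ 2 - 1) ^ n := by ring
    rw [this, iterate_derivative_sub, iterate_derivative_mul_X, iterate_derivative_mul_X,
      Nat.add_sub_cancel, iterate_derivative_mul_X]
    simp only [nsmul_eq_mul]
    push_cast
    ring
  unfold legendreP
  rw [derivative_C_mul, ← Function.iterate_succ_apply' derivative]
  have h3 : derivative^[n + 1] (((X : ℝ[X]) ^ 2 - 1) ^ (n + 1)) =
      C 2 * ((X ^ 2 - 1) * derivative^[n + 1] (((X : ℝ[X]) ^ 2 - 1) ^ n)) +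
      C (2 * ((n : ℝ) + 1)) * X * derivative^[n] (((X : ℝ[X]) ^ 2 - 1) ^ n) := by
    have h4 : (C (2 * ((n : ℝ) + 1)) : ℝ[X]) = 2 * ((n : ℝ[X]) + 1) := by
      simp only [C_mul, C_add, C_1, map_natCast]; rfl
    have h5 : (C (2 : ℝ) : ℝ[X]) = 2 := rfl
    rw [h4] at h1 ⊢
    rw [h5]
    linear_combination 2 * h2 - h1
  have hc1 : ((n : ℝ) + 1) * (1 / (2 ^ (n + 1) * ((n + 1)! : ℝ))) * 2 = 1 / (2 ^ n * (n ! : ℝ)) := by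
    rw [Nat.factorial_succ]; push_cast; field_simp; ring
  have hc2 : ((n : ℝ) + 1) * (1 / (2 ^ (n + 1) * ((n + 1)! : ℝ))) * (2 * ((n : ℝ) + 1)) =
      ((n : ℝ) + 1) * (1 / (2 ^ n * (n ! : ℝ))) := by
    rw [Nat.factorial_succ]; push_cast; field_simp; ring
  have e1 : (C ((n : ℝ) + 1) * C (1 / (2 ^ (n + 1) * ((n + 1)! : ℝ))) * C 2 : ℝ[X]) =
      C (1 / (2 ^ n * (n ! : ℝ))) := by rw [← C_mul, ← C_mul, hc1]
  have e2 : (C ((n : ℝ) + 1) * C (1 / (2 ^ (n + 1) * ((n + 1)! : ℝ))) * C (2 * ((n : ℝ) + 1)) :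
      ℝ[X]) = C ((n : ℝ) + 1) * C (1 / (2 ^ n * (n ! : ℝ))) := by
    rw [← C_mul, ← C_mul, hc2, C_mul]
  rw [h3]
  linear_combination ((X ^ 2 - 1) * derivative^[n + 1] (((X : ℝ[X]) ^ 2 - 1) ^ n)) * e1 +
    (X * derivative^[n] (((X : ℝ[X]) ^ 2 - 1) ^ n)) * e2

open Polynomial in
-- The factor X - 1 becomes -r²/2 under t = 1 - r²/2; this relation drives the recurrence of the
-- radial integrals.
theorem succ_mul_legendreP_succ_sub (n : ℕ) :
    C ((n : ℝ) + 1) * (legendreP (n + 1) - legendreP n) =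
      (X - 1) * (derivative (legendreP (n + 1)) + derivative (legendreP n)) := by
  linear_combination succ_mul_legendreP_succ n - (X - 1) * derivative_legendreP_succ n

theorem legendreP_zero : legendreP 0 = 1 := by simp [legendreP]

theorem legendreP_eval_of_sq_eq_one (n : ℕ) {t : ℝ} (ht : t ^ 2 = 1) :
    (legendreP n).eval t = t ^ n := by
  induction n with
  | zero => simp [legendreP_zero]
  | succ n ih =>
    have h := congrArg (Polynomial.eval t) (succ_mul_legendreP_succ n)
    simp only [Polynomial.eval_mul, Polynomial.eval_C, Polynomial.eval_add, Polynomial.eval_sub,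
      Polynomial.eval_pow, Polynomial.eval_X, Polynomial.eval_one, ih, ht] at h
    have hn : (n : ℝ) + 1 ≠ 0 := by positivity
    apply mul_left_cancel₀ hn
    rw [h]; ring

/-! ### Associated Legendre functions as coefficients of powers -/

open Polynomial in
theorem iterate_derivative_legendreP_eval (n μ : ℕ) (t : ℝ) :
    (derivative^[μ] (legendreP n)).eval t = 1 / (2 ^ n * (n ! : ℝ)) * ((n + μ)! : ℝ) *
      (taylor t (((X : ℝ[X]) ^ 2 - 1) ^ n)).coeff (n + μ) := by
  unfold legendreP
  rw [iterate_derivative_C_mul, ← Function.iterate_add_apply, add_comm μ n,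
    ← factorial_smul_hasseDeriv, taylor_coeff]
  simp [mul_assoc]

/-- The generating function of the associated Legendre functions: the coefficients of powers of
linear forms with isotropic coefficient vector. -/
theorem coeff_isotropic_pow (n μ : ℕ) (t : ℝ) (u v : ℂ) (h : 4 * u * v = (t : ℂ) ^ 2 - 1) :
    ((Polynomial.C (t : ℂ) * Polynomial.X + Polynomial.C u * Polynomial.X ^ 2 +
      Polynomial.C v) ^ n).coeff (n + μ) =
      (2 * u) ^ μ * ((n ! : ℂ) / ((n + μ)! : ℂ)) *
        (((Polynomial.derivative^[μ] (legendreP n)).eval t : ℝ) : ℂ) := by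
  open Polynomial in
  -- The main argument divides by 4u. If u = 0 then t² = 1 and the base has degree at most 1, so
  -- only the coefficient with μ = 0 can survive.
  by_cases hu : u = 0
  · subst hu
    have ht : t ^ 2 = 1 := by
      have : (t : ℂ) ^ 2 = 1 := by linear_combination -h
      exact_mod_cast this
    have hd : (C (t : ℂ) * X + C v).natDegree ≤ 1 := natDegree_linear_le
    simp only [map_zero, zero_mul, add_zero, mul_zero]
    rcases Nat.eq_zero_or_pos μ with rfl | hμ
    · have := coeff_pow_of_natDegree_le (m := n) hd
      rw [mul_one] at this
      rw [add_zero, this]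
      simp [legendreP_eval_of_sq_eq_one n ht, Nat.factorial_ne_zero]
    · rw [coeff_eq_zero_of_natDegree_lt]
      · simp [hμ.ne']
      · refine lt_of_le_of_lt (natDegree_pow_le_of_le n hd) (by omega)
  -- Completing the square: 4u(tX + uX² + v) = (2uX + t)² - 1. The powers thus carry the Taylor
  -- coefficients of (x² - 1)^n at t, which are derivatives of P_n by Rodrigues.
  · have key : C ((4 * u) ^ n) * (C (t : ℂ) * X + C u * X ^ 2 + C v) ^ n =
        (taylor (t : ℂ) ((X ^ 2 - 1) ^ n)).comp (C (2 * u) * X) := by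
      have h1 : (C (4 * u) * (C (t : ℂ) * X + C u * X ^ 2 + C v) : ℂ[X]) =
          (C (2 * u) * X + C (t : ℂ)) ^ 2 - 1 := by
        have h2 : (C (4 * u * v) : ℂ[X]) = C ((t : ℂ) ^ 2 - 1) := by rw [h]
        simp only [C_mul, C_sub, C_pow, C_1] at h2 ⊢
        have h3 : (C 4 : ℂ[X]) = 4 := rfl
        have h4 : (C 2 : ℂ[X]) = 2 := rfl
        rw [h3] at h2 ⊢
        rw [h4]
        linear_combination h2
      rw [C_pow, ← mul_pow, h1]
      simp [taylor_apply]
    have hmap : (taylor (t : ℂ) (((X : ℂ[X]) ^ 2 - 1) ^ n)).coeff (n + μ) =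
        ((taylor t (((X : ℝ[X]) ^ 2 - 1) ^ n)).coeff (n + μ) : ℝ) := by
      have : (taylor (t : ℂ) (((X : ℂ[X]) ^ 2 - 1) ^ n)) =
          (taylor t (((X : ℝ[X]) ^ 2 - 1) ^ n)).map Complex.ofRealHom := by
        simp [taylor_apply]
      rw [this, coeff_map]; rfl
    have hk := congrArg (fun p => coeff p (n + μ)) key
    simp only [coeff_C_mul, comp_C_mul_X_coeff, hmap] at hk
    rw [iterate_derivative_legendreP_eval]
    have h4 : (4 * u) ^ n ≠ 0 := pow_ne_zero _ (by simpa using hu)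
    apply mul_left_cancel₀ h4
    rw [hk]
    have hf : (((n + μ)! : ℕ) : ℂ) ≠ 0 := by exact_mod_cast Nat.factorial_ne_zero _
    have hf' : ((n ! : ℕ) : ℂ) ≠ 0 := by exact_mod_cast Nat.factorial_ne_zero _
    push_cast
    field_simp
    have h2 : (4 : ℂ) ^ n = 2 ^ n * 2 ^ n := by rw [← mul_pow]; norm_num
    simp only [mul_pow, pow_add, h2]
    ring

/-! ### The surface measure: isometry invariance and the hat-box theorem -/

/-- The action of a linear isometry on the unit sphere. -/
noncomputable def LinearIsometryEquiv.onUnitSphere (U : Space3 ≃ₗᵢ[ℝ] Space3) (y : UnitSphere) : UnitSphere :=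
  ⟨U y, by simp⟩

@[simp]
theorem LinearIsometryEquiv.coe_onUnitSphere (U : Space3 ≃ₗᵢ[ℝ] Space3) (y : UnitSphere) :
    (U.onUnitSphere y : Space3) = U y := rfl

theorem LinearIsometryEquiv.continuous_onUnitSphere (U : Space3 ≃ₗᵢ[ℝ] Space3) :
    Continuous U.onUnitSphere :=
  Continuous.subtype_mk (U.continuous.comp continuous_subtype_val) _

theorem LinearIsometryEquiv.onUnitSphere_symm_onUnitSphere (U : Space3 ≃ₗᵢ[ℝ] Space3)
    (y : UnitSphere) : U.symm.onUnitSphere (U.onUnitSphere y) = y := by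
  ext1; simp

theorem LinearIsometryEquiv.onUnitSphere_onUnitSphere_symm (U : Space3 ≃ₗᵢ[ℝ] Space3)
    (y : UnitSphere) : U.onUnitSphere (U.symm.onUnitSphere y) = y := by
  ext1; simp

theorem LinearIsometryEquiv.measurableEmbedding_onUnitSphere (U : Space3 ≃ₗᵢ[ℝ] Space3) :
    MeasurableEmbedding U.onUnitSphere :=
  (Homeomorph.mk ⟨U.onUnitSphere, U.symm.onUnitSphere, U.onUnitSphere_symm_onUnitSphere,
    U.onUnitSphere_onUnitSphere_symm⟩ U.continuous_onUnitSphere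
    U.symm.continuous_onUnitSphere).measurableEmbedding

open scoped Pointwise in
/-- The surface measure of the sphere is invariant under linear isometries. -/
theorem LinearIsometryEquiv.measurePreserving_onUnitSphere (U : Space3 ≃ₗᵢ[ℝ] Space3) :
    MeasurePreserving U.onUnitSphere (volume : Measure Space3).toSphere
      (volume : Measure Space3).toSphere := by
  refine ⟨U.continuous_onUnitSphere.measurable, ?_⟩
  ext s hs
  rw [Measure.map_apply U.continuous_onUnitSphere.measurable hs, Measure.toSphere_apply' _ hs,
    Measure.toSphere_apply' _ (U.continuous_onUnitSphere.measurable hs)]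
  have : Set.Ioo (0 : ℝ) 1 • (((↑) : UnitSphere → Space3) '' (U.onUnitSphere ⁻¹' s)) =
      U ⁻¹' (Set.Ioo (0 : ℝ) 1 • (((↑) : UnitSphere → Space3) '' s)) := by
    ext z
    simp only [Set.mem_smul, Set.mem_image, Set.mem_preimage]
    constructor
    · rintro ⟨r, hr, _, ⟨y, hy, rfl⟩, rfl⟩
      exact ⟨r, hr, _, ⟨_, hy, rfl⟩, by simp⟩
    · rintro ⟨r, hr, _, ⟨y, hy, rfl⟩, h⟩
      refine ⟨r, hr, _, ⟨U.symm.onUnitSphere y, ?_, rfl⟩, ?_⟩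
      · rwa [U.onUnitSphere_onUnitSphere_symm]
      · apply U.injective
        rw [← h]; simp
  rw [this, U.measurePreserving.measure_preimage_emb U.toHomeomorph.measurableEmbedding]

/-- Finite measures on the line that live on a bounded interval are determined by their moments. -/
theorem measure_ext_of_moments {μ ν : Measure ℝ} [IsFiniteMeasure μ] [IsFiniteMeasure ν] (a b : ℝ)
    (hμ : ∀ᵐ x ∂μ, x ∈ Set.Icc a b) (hν : ∀ᵐ x ∂ν, x ∈ Set.Icc a b)
    (h : ∀ p : ℕ, ∫ x, x ^ p ∂μ = ∫ x, x ^ p ∂ν) : μ = ν := by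
  have key : ∀ (κ : Measure ℝ) [IsFiniteMeasure κ], (∀ᵐ x ∂κ, x ∈ Set.Icc a b) →
      ∀ f : ℝ → ℝ, Continuous f → Integrable f κ := by
    intro κ _ hκ f hf
    obtain ⟨C, hC⟩ := (isCompact_Icc (a := a) (b := b)).exists_bound_of_continuousOn hf.continuousOn
    exact Integrable.of_bound hf.aestronglyMeasurable C (hκ.mono fun x hx => hC x hx)
  have hpoly : ∀ p : Polynomial ℝ, ∫ x, p.eval x ∂μ = ∫ x, p.eval x ∂ν := by
    intro p
    simp only [Polynomial.eval_eq_sum_range]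
    rw [integral_finsetSum _ fun i _ => key μ hμ _ (by fun_prop),
      integral_finsetSum _ fun i _ => key ν hν _ (by fun_prop)]
    simp only [integral_const_mul, h]
  apply ext_of_forall_integral_eq_of_IsFiniteMeasure
  intro f
  -- Weierstrass approximation on [a, b]: polynomials have equal integrals, and each replacement
  -- costs at most ε times the total mass.
  have hest : ∀ ε > 0, |∫ x, f x ∂μ - ∫ x, f x ∂ν| ≤ ε * (μ.real Set.univ + ν.real Set.univ) := by
    intro ε hε
    obtain ⟨p, hp⟩ := exists_polynomial_near_of_continuousOn a b f f.continuous.continuousOn ε hε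
    have hb : ∀ (κ : Measure ℝ) [IsFiniteMeasure κ], (∀ᵐ x ∂κ, x ∈ Set.Icc a b) →
        |∫ x, f x ∂κ - ∫ x, p.eval x ∂κ| ≤ ε * κ.real Set.univ := by
      intro κ _ hκ
      rw [← integral_sub (key κ hκ _ f.continuous) (key κ hκ _ p.continuous)]
      have hx : ∀ᵐ x ∂κ, ‖f x - p.eval x‖ ≤ ε := hκ.mono fun x hx => by
        rw [Real.norm_eq_abs, abs_sub_comm]
        exact (hp x hx).le
      exact norm_integral_le_of_norm_le_const hx
    have h1 := hb μ hμ
    have h2 := hb ν hν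
    rw [hpoly] at h1
    rw [abs_le] at *
    constructor <;> linarith
  have hz : |∫ x, f x ∂μ - ∫ x, f x ∂ν| ≤ 0 := by
    refine ge_of_tendsto (x := 𝓝[>] (0 : ℝ))
      (f := fun ε => ε * (μ.real Set.univ + ν.real Set.univ)) ?_ ?_
    · have : Tendsto (fun ε : ℝ => ε * (μ.real Set.univ + ν.real Set.univ)) (𝓝 0)
          (𝓝 (0 * (μ.real Set.univ + ν.real Set.univ))) := (continuous_mul_const _).tendsto 0
      rw [zero_mul] at this
      exact this.mono_left nhdsWithin_le_nhds
    · filter_upwards [self_mem_nhdsWithin] with ε hε using hest ε hε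
  exact sub_eq_zero.mp (abs_eq_zero.mp (le_antisymm hz (abs_nonneg _)))

theorem integral_pow_mul_exp_neg_sq_Ioi (p : ℕ) :
    ∫ x in Set.Ioi (0 : ℝ), x ^ p * Real.exp (-x ^ 2) = Real.Gamma ((p + 1) / 2) / 2 := by
  have h := integral_rpow_mul_exp_neg_rpow (p := 2) (q := p) two_pos (by
    have : (0 : ℝ) ≤ p := by positivity
    linarith)
  simp only [Real.rpow_natCast, Real.rpow_two] at h
  rw [h]; ring

theorem integral_pow_mul_exp_neg_sq_of_even {p : ℕ} (hp : Even p) :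
    ∫ x : ℝ, x ^ p * Real.exp (-x ^ 2) = Real.Gamma ((p + 1) / 2) := by
  have h := integral_comp_abs (f := fun x : ℝ => x ^ p * Real.exp (-x ^ 2))
  simp only [hp.pow_abs, sq_abs] at h
  rw [h, integral_pow_mul_exp_neg_sq_Ioi]; ring

theorem integral_pow_mul_exp_neg_sq_of_odd {p : ℕ} (hp : Odd p) :
    ∫ x : ℝ, x ^ p * Real.exp (-x ^ 2) = 0 := by
  have h := integral_neg_eq_self (fun x : ℝ => x ^ p * Real.exp (-x ^ 2)) volume
  simp only [hp.neg_pow, neg_sq, neg_mul, integral_neg] at h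
  linarith

theorem integral_coord_pow_mul_exp_neg_norm_sq (p : ℕ) :
    ∫ z : Space3, z 2 ^ p * Real.exp (-‖z‖ ^ 2) =
      Real.pi * ∫ x : ℝ, x ^ p * Real.exp (-x ^ 2) := by
  rw [← (PiLp.volume_preserving_toLp (Fin 3)).integral_comp
    (MeasurableEquiv.toLp 2 _).measurableEmbedding]
  have h : ∀ x : Fin 3 → ℝ, (WithLp.toLp 2 x : Space3) 2 ^ p *
      Real.exp (-‖(WithLp.toLp 2 x : Space3)‖ ^ 2) =
      ∏ i : Fin 3, (if i = 2 then fun t : ℝ => t ^ p * Real.exp (-t ^ 2)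
        else fun t : ℝ => Real.exp (-t ^ 2)) (x i) := by
    intro x
    rw [EuclideanSpace.norm_sq_eq, Fin.prod_univ_three, Fin.sum_univ_three]
    simp only [Real.norm_eq_abs, sq_abs]
    rw [show -(x 0 ^ 2 + x 1 ^ 2 + x 2 ^ 2) = -x 0 ^ 2 + -x 1 ^ 2 + -x 2 ^ 2 by ring, Real.exp_add,
      Real.exp_add]
    simp
    ring
  have hg : ∫ t : ℝ, Real.exp (-t ^ 2) = Real.sqrt Real.pi := by
    have := integral_gaussian 1
    simpa using this
  simp only [h]
  rw [integral_fintype_prod_volume_eq_prod, Fin.prod_univ_three]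
  simp [hg, Real.mul_self_sqrt Real.pi_pos.le]

/-- Polar coordinates for a homogeneous function times a Gaussian. -/
theorem integral_coord_pow_mul_exp_eq_sphere (p : ℕ) :
    ∫ z : Space3, z 2 ^ p * Real.exp (-‖z‖ ^ 2) =
      (∫ y : UnitSphere, (y : Space3) 2 ^ p ∂(volume : Measure Space3).toSphere) *
        (Real.Gamma ((p + 3) / 2) / 2) := by
  let f : Space3 → ℝ := fun z => z 2 ^ p * Real.exp (-‖z‖ ^ 2)
  have hdim : Module.finrank ℝ Space3 = 3 := by simp
  calc ∫ z : Space3, f z = ∫ x : ({(0 : Space3)}ᶜ : Set Space3), f (x : Space3)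
          ∂(volume.comap ((↑) : ({(0 : Space3)}ᶜ : Set Space3) → Space3)) := by
        rw [integral_subtype_comap (measurableSet_singleton _).compl f, restrict_compl_singleton]
    _ = ∫ x : UnitSphere × Set.Ioi (0 : ℝ), f ((x.2 : ℝ) • (x.1 : Space3))
          ∂(volume : Measure Space3).toSphere.prod (.volumeIoiPow (Module.finrank ℝ Space3 - 1)) := by
        rw [← (volume : Measure Space3).measurePreserving_homeomorphUnitSphereProd.integral_comp
          (Homeomorph.measurableEmbedding _)]
        refine integral_congr_ae (.of_forall fun x => ?_)
        have hx : (x : Space3) ≠ 0 := x.2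
        simp [hx]
    _ = ∫ x : UnitSphere × Set.Ioi (0 : ℝ), (x.1 : Space3) 2 ^ p *
          ((x.2 : ℝ) ^ p * Real.exp (-(x.2 : ℝ) ^ 2))
          ∂(volume : Measure Space3).toSphere.prod (.volumeIoiPow (Module.finrank ℝ Space3 - 1)) := by
        congr 1; ext x
        have : ‖(x.1 : Space3)‖ = 1 := by simp
        have h2 : |(x.2 : ℝ)| ^ 2 = (x.2 : ℝ) ^ 2 := sq_abs _
        simp only [f, norm_smul, this, mul_one, Real.norm_eq_abs, h2, PiLp.smul_apply, smul_eq_mul,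
          mul_pow]
        ring
    _ = _ := by
        rw [integral_prod_mul (fun y : UnitSphere => (y : Space3) 2 ^ p)
          (fun r : Set.Ioi (0 : ℝ) => (r : ℝ) ^ p * Real.exp (-(r : ℝ) ^ 2))]
        congr 1
        rw [hdim]
        simp only [Measure.volumeIoiPow, ENNReal.ofReal]
        rw [integral_withDensity_eq_integral_smul, integral_subtype_comap measurableSet_Ioi
          fun a ↦ Real.toNNReal (a ^ (3 - 1)) • (a ^ p * Real.exp (-a ^ 2))]
        -- The exponent is p + 2 because the radial measure in dimension 3 is r² dr.
        · have := integral_pow_mul_exp_neg_sq_Ioi (p + 2)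
          rw [show (((p + 2 : ℕ) : ℝ) + 1) / 2 = (p + 3) / 2 by push_cast; ring] at this
          rw [← this]
          refine setIntegral_congr_fun measurableSet_Ioi fun x hx ↦ ?_
          have hx' : (0 : ℝ) ≤ x := le_of_lt hx
          simp only [NNReal.smul_def, Real.coe_toNNReal _ (pow_nonneg hx' _), smul_eq_mul]
          ring
        · exact (measurable_subtype_coe.pow_const _).real_toNNReal

/-- The Gaussian moment of one coordinate is evaluated in Cartesian and in polar coordinates. For
even p the Gamma factors cancel and leave 4π/(p + 1); for odd p both sides vanish. -/
theorem integral_coord_pow_toSphere (p : ℕ) :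
    ∫ y : UnitSphere, (y : Space3) 2 ^ p ∂(volume : Measure Space3).toSphere =
      2 * Real.pi * ∫ t in (-1 : ℝ)..1, t ^ p := by
  have h := (integral_coord_pow_mul_exp_eq_sphere p).symm.trans
    (integral_coord_pow_mul_exp_neg_norm_sq p)
  have hG : Real.Gamma (((p : ℝ) + 3) / 2) = (p + 1) / 2 * Real.Gamma ((p + 1) / 2) := by
    rw [← Real.Gamma_add_one (by positivity)]; congr 1; ring
  have hpos : 0 < Real.Gamma (((p : ℝ) + 1) / 2) := Real.Gamma_pos_of_pos (by positivity)
  have hp : (p : ℝ) + 1 ≠ 0 := by positivity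
  rw [hG] at h
  rw [integral_pow]
  rcases Nat.even_or_odd p with he | ho
  · rw [integral_pow_mul_exp_neg_sq_of_even he] at h
    rw [he.add_one.neg_one_pow]
    field_simp at h ⊢
    linear_combination h
  · rw [integral_pow_mul_exp_neg_sq_of_odd ho] at h
    rw [ho.add_one.neg_one_pow]
    have : ((p : ℝ) + 1) / 2 * Real.Gamma ((p + 1) / 2) / 2 ≠ 0 := by positivity
    have h0 := (mul_eq_zero.mp (h.trans (mul_zero _))).resolve_right this
    rw [h0]; simp

theorem UnitSphere.abs_coord_le (y : UnitSphere) (i : Fin 3) : |(y : Space3) i| ≤ 1 := by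
  have := PiLp.norm_apply_le (y : Space3) i
  simpa using this

/-- Archimedes' hat-box theorem: the surface measure projects to a multiple of the Lebesgue
measure on a diameter. -/
theorem map_coord_toSphere :
    (volume : Measure Space3).toSphere.map (fun y : UnitSphere => (y : Space3) 2) =
      ENNReal.ofReal (2 * Real.pi) • volume.restrict (Set.Icc (-1 : ℝ) 1) := by
  have hm : Continuous (fun y : UnitSphere => (y : Space3) 2) := by fun_prop
  have : IsFiniteMeasure (ENNReal.ofReal (2 * Real.pi) • volume.restrict (Set.Icc (-1 : ℝ) 1)) :=
    Measure.smul_finite _ ENNReal.ofReal_ne_top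
  refine measure_ext_of_moments (-1) 1 ?_ ?_ fun p => ?_
  · exact (ae_map_iff (p := fun t : ℝ => t ∈ Set.Icc (-1 : ℝ) 1) hm.aemeasurable
      measurableSet_Icc).mpr (.of_forall fun y => abs_le.mp (y.abs_coord_le 2))
  · exact Measure.ae_smul_measure (ae_restrict_mem measurableSet_Icc) _
  · rw [integral_map hm.aemeasurable (by fun_prop), integral_coord_pow_toSphere,
      integral_smul_measure, ENNReal.toReal_ofReal (by positivity), integral_Icc_eq_integral_Ioc,
      intervalIntegral.integral_of_le (by norm_num), smul_eq_mul]

/-! ### The Funk–Hecke formula -/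

open Polynomial in
-- The case μ = 0 of `coeff_isotropic_pow`, made homogeneous by a scale α. The value α = 0, where
-- one cannot rescale, is needed for isotropic vectors whose axial component vanishes.
theorem coeff_isotropic_pow_center (n : ℕ) (t : ℝ) (α u v : ℂ)
    (h : 4 * u * v = α ^ 2 * ((t : ℂ) ^ 2 - 1)) :
    ((C (α * t) * X + C u * X ^ 2 + C v) ^ n).coeff n =
      α ^ n * (((legendreP n).eval t : ℝ) : ℂ) := by
  by_cases hα : α = 0
  · subst hα
    have huv : u = 0 ∨ v = 0 := by simpa using h
    rcases Nat.eq_zero_or_pos n with rfl | hn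
    · simp [legendreP_zero]
    · simp only [zero_mul, C_0, zero_add, zero_pow hn.ne']
      rcases huv with rfl | rfl
      · rw [C_0, zero_mul, zero_add, ← C_pow, coeff_C_of_ne_zero hn.ne']
      · rw [C_0, add_zero, mul_pow, ← C_pow, ← pow_mul, coeff_C_mul, coeff_X_pow, if_neg (by omega),
          mul_zero]
  · have h1 : (C (α * t) * X + C u * X ^ 2 + C v : ℂ[X]) =
        C α * (C (t : ℂ) * X + C (u / α) * X ^ 2 + C (v / α)) := by
      have h2 : (C u : ℂ[X]) = C α * C (u / α) := by rw [← C_mul, mul_div_cancel₀ _ hα]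
      have h3 : (C v : ℂ[X]) = C α * C (v / α) := by rw [← C_mul, mul_div_cancel₀ _ hα]
      rw [h2, h3, C_mul]; ring
    have h4 := coeff_isotropic_pow n 0 t (u / α) (v / α) (by field_simp; linear_combination h)
    rw [h1, mul_pow, ← C_pow, coeff_C_mul]
    simp only [add_zero] at h4
    rw [h4]
    simp [Nat.factorial_ne_zero]

theorem continuous_coeff_pow {Y R : Type*} [TopologicalSpace Y] [CommRing R] [TopologicalSpace R]
    [IsTopologicalRing R] {p : Y → Polynomial R} (hp : ∀ j, Continuous fun y => (p y).coeff j)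
    (n j : ℕ) : Continuous fun y => (p y ^ n).coeff j := by
  induction n generalizing j with
  | zero => simp only [pow_zero]; exact continuous_const
  | succ n ih =>
    simp only [pow_succ, Polynomial.coeff_mul]
    exact continuous_finsetSum _ fun i _ => (ih _).mul (hp _)

open Polynomial in
theorem continuous_coeff_quadratic_pow {Y R : Type*} [TopologicalSpace Y] [CommRing R]
    [TopologicalSpace R] [IsTopologicalRing R] {a b c : Y → R} (ha : Continuous a)
    (hb : Continuous b) (hc : Continuous c) (n j : ℕ) :
    Continuous fun y => ((C (a y) * X + C (b y) * X ^ 2 + C (c y)) ^ n).coeff j := by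
  refine continuous_coeff_pow (fun j => ?_) n j
  have : ∀ y, (C (a y) * X + C (b y) * X ^ 2 + C (c y)).coeff j =
      a y * (X : R[X]).coeff j + b y * (X ^ 2 : R[X]).coeff j + c y * (1 : R[X]).coeff j := by
    intro y
    rw [← mul_one (C (c y))]
    simp only [coeff_add, coeff_C_mul]
  simp only [this]
  fun_prop

open Polynomial in
theorem eval_quadratic_pow_eq_sum {R : Type*} [CommRing R] (a b c w : R) (n : ℕ) :
    (a * w + b * w ^ 2 + c) ^ n = ∑ j ∈ Finset.range (2 * n + 1),
      ((C a * X + C b * X ^ 2 + C c) ^ n).coeff j * w ^ j := by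
  have hd : ((C a * X + C b * X ^ 2 + C c) ^ n).natDegree < 2 * n + 1 := by
    have : (C a * X + C b * X ^ 2 + C c).natDegree ≤ 2 := by compute_degree
    have := natDegree_pow_le_of_le n this
    omega
  rw [← eval_eq_sum_range' hd]
  simp

theorem integrable_comp_coord_toSphere {F : ℝ → ℂ} (hF : IntegrableOn F (Set.Icc (-1) 1)) :
    Integrable (fun y : UnitSphere => F ((y : Space3) 2)) (volume : Measure Space3).toSphere := by
  have hm : Continuous (fun y : UnitSphere => (y : Space3) 2) := by fun_prop
  have h : Integrable F
      ((volume : Measure Space3).toSphere.map (fun y : UnitSphere => (y : Space3) 2)) := by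
    rw [map_coord_toSphere]
    exact Integrable.smul_measure hF ENNReal.ofReal_ne_top
  exact (integrable_map_measure h.aestronglyMeasurable hm.aemeasurable).mp h

theorem integral_comp_coord_toSphere {F : ℝ → ℂ} (hF : IntegrableOn F (Set.Icc (-1) 1)) :
    ∫ y : UnitSphere, F ((y : Space3) 2) ∂(volume : Measure Space3).toSphere =
      2 * Real.pi * ∫ t in Set.Icc (-1 : ℝ) 1, F t := by
  have hm : Continuous (fun y : UnitSphere => (y : Space3) 2) := by fun_prop
  have h : Integrable F
      ((volume : Measure Space3).toSphere.map (fun y : UnitSphere => (y : Space3) 2)) := by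
    rw [map_coord_toSphere]
    exact Integrable.smul_measure hF ENNReal.ofReal_ne_top
  rw [← integral_map hm.aemeasurable h.aestronglyMeasurable, map_coord_toSphere,
    integral_smul_measure, ENNReal.toReal_ofReal (by positivity), Complex.real_smul]
  push_cast
  rfl

theorem MeasureTheory.Integrable.mul_continuous_of_compact {Y : Type*} [TopologicalSpace Y]
    [CompactSpace Y] [MeasurableSpace Y] [OpensMeasurableSpace Y] {μ : Measure Y} {f g : Y → ℂ}
    (hf : Integrable f μ) (hg : Continuous g) : Integrable (fun y => f y * g y) μ := by
  obtain ⟨C, hC⟩ := isCompact_univ.exists_bound_of_continuousOn (f := g) hg.continuousOn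
  exact hf.mul_bdd (c := C) hg.aestronglyMeasurable (.of_forall fun y => hC y (Set.mem_univ y))

/-- Rotation about the third coordinate axis. -/
noncomputable def axisRotation (θ : ℝ) : Space3 ≃ₗᵢ[ℝ] Space3 :=
  LinearIsometry.toLinearIsometryEquiv
    { toFun := fun y => !₂[Real.cos θ * y 0 - Real.sin θ * y 1,
        Real.sin θ * y 0 + Real.cos θ * y 1, y 2]
      map_add' := fun y z => by
        ext i
        fin_cases i <;> simp <;> ring
      map_smul' := fun c y => by
        ext i
        fin_cases i <;> simp <;> ring
      norm_map' := fun y => by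
        simp only [EuclideanSpace.norm_eq, Fin.sum_univ_three, Real.norm_eq_abs, sq_abs,
          LinearMap.coe_mk, AddHom.coe_mk]
        congr 1
        simp
        linear_combination (y 0 ^ 2 + y 1 ^ 2) * Real.sin_sq_add_cos_sq θ } rfl

theorem axisRotation_apply (θ : ℝ) (y : Space3) :
    axisRotation θ y = !₂[Real.cos θ * y 0 - Real.sin θ * y 1,
        Real.sin θ * y 0 + Real.cos θ * y 1, y 2] := rfl

theorem UnitSphere.sum_sq_coord (y : UnitSphere) :
    (y : Space3) 0 ^ 2 + (y : Space3) 1 ^ 2 + (y : Space3) 2 ^ 2 = 1 := by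
  have h : ‖(y : Space3)‖ ^ 2 = 1 := by simp
  rw [EuclideanSpace.norm_sq_eq, Fin.sum_univ_three] at h
  simpa using h

open Polynomial in
/-- The Funk–Hecke formula at the north pole for powers of isotropic linear forms. -/
theorem funkHecke_isotropic_pole {F : ℝ → ℂ} (hF : IntegrableOn F (Set.Icc (-1) 1)) (n : ℕ)
    (a : Fin 3 → ℂ) (ha : a 0 ^ 2 + a 1 ^ 2 + a 2 ^ 2 = 0) :
    ∫ y : UnitSphere, F ((y : Space3) 2) * (a 0 * (y : Space3) 0 + a 1 * (y : Space3) 1 +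
        a 2 * (y : Space3) 2) ^ n ∂(volume : Measure Space3).toSphere =
      (2 * Real.pi * ∫ t in Set.Icc (-1 : ℝ) 1, F t * ((legendreP n).eval t : ℝ)) * a 2 ^ n := by
  -- The form a·y splits as e + b + c, of frequencies 0, 1 and -1 under rotation about the axis. In
  -- (eX + bX² + c)^n the coefficient of X^j has frequency j - n, and isotropy of a gives 4bc =
  -- a₂²(y₂² - 1).
  let b : UnitSphere → ℂ := fun y => ((y : Space3) 0 + Complex.I * (y : Space3) 1) *
    ((a 0 - Complex.I * a 1) / 2)
  let c : UnitSphere → ℂ := fun y => ((y : Space3) 0 - Complex.I * (y : Space3) 1) *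
    ((a 0 + Complex.I * a 1) / 2)
  let e : UnitSphere → ℂ := fun y => a 2 * ((y : Space3) 2 : ℝ)
  let f : ℕ → UnitSphere → ℂ := fun j y => ((C (e y) * X + C (b y) * X ^ 2 + C (c y)) ^ n).coeff j
  have hf : ∀ j, Continuous (f j) := fun j =>
    continuous_coeff_quadratic_pow (by fun_prop) (by fun_prop) (by fun_prop) n j
  have hint : ∀ j, Integrable (fun y : UnitSphere => F ((y : Space3) 2) * f j y)
      (volume : Measure Space3).toSphere := fun j =>
    (integrable_comp_coord_toSphere hF).mul_continuous_of_compact (hf j)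
  have hexp : ∀ y : UnitSphere, (a 0 * (y : Space3) 0 + a 1 * (y : Space3) 1 +
      a 2 * (y : Space3) 2) ^ n = ∑ j ∈ Finset.range (2 * n + 1), f j y := by
    intro y
    have h := eval_quadratic_pow_eq_sum (e y) (b y) (c y) 1 n
    simp only [one_pow, mul_one] at h
    rw [← h]
    congr 1
    simp only [e, b, c]
    linear_combination (a 1 * (y : Space3) 1) * Complex.I_sq
  have hcenter : ∀ y : UnitSphere, f n y = a 2 ^ n * ((legendreP n).eval ((y : Space3) 2) : ℝ) := by
    intro y
    apply coeff_isotropic_pow_center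
    have h1 : (((y : Space3) 0 : ℝ) : ℂ) ^ 2 + ((y : Space3) 1 : ℝ) ^ 2 + ((y : Space3) 2 : ℝ) ^ 2
        = 1 := by
      have := congrArg Complex.ofReal y.sum_sq_coord
      push_cast at this
      exact this
    simp only [b, c]
    have hI := Complex.I_sq
    have h2 : 4 * ((((y : Space3) 0 : ℝ) + Complex.I * ((y : Space3) 1 : ℝ)) *
        ((a 0 - Complex.I * a 1) / 2)) * ((((y : Space3) 0 : ℝ) - Complex.I * ((y : Space3) 1 : ℝ)) *
        ((a 0 + Complex.I * a 1) / 2)) =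
        (((y : Space3) 0 : ℝ) ^ 2 - Complex.I ^ 2 * ((y : Space3) 1 : ℝ) ^ 2) *
        (a 0 ^ 2 - Complex.I ^ 2 * a 1 ^ 2) := by ring
    rw [h2, hI]
    linear_combination (a 0 ^ 2 + a 1 ^ 2) * h1 + (1 - (((y : Space3) 2 : ℝ) : ℂ) ^ 2) * ha
  have hzero : ∀ j ∈ Finset.range (2 * n + 1), j ≠ n →
      ∫ y : UnitSphere, F ((y : Space3) 2) * f j y ∂(volume : Measure Space3).toSphere = 0 := by
    intro j hj hjn
    -- A single rotation of order 2n + 1 suffices: for 0 ≤ j ≤ 2n the multiplier ζ^{j-n} equals 1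
    -- only when j = n.
    let θ : ℝ := 2 * Real.pi / ((2 * n + 1 : ℕ) : ℝ)
    let ζ : ℂ := Complex.exp (2 * Real.pi * Complex.I / ((2 * n + 1 : ℕ) : ℂ))
    have hprim : IsPrimitiveRoot ζ (2 * n + 1) := Complex.isPrimitiveRoot_exp _ (by omega)
    have hζ0 : ζ ≠ 0 := Complex.exp_ne_zero _
    have hζ : ζ = Real.cos θ + Real.sin θ * Complex.I := by
      rw [Complex.ofReal_cos, Complex.ofReal_sin, ← Complex.exp_mul_I]
      simp only [ζ, θ]
      congr 1
      push_cast
      ring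
    have hζi : ζ⁻¹ = Real.cos θ - Real.sin θ * Complex.I := by
      apply inv_eq_of_mul_eq_one_right
      rw [hζ]
      have := Real.sin_sq_add_cos_sq θ
      have h' : ((Real.sin θ : ℝ) : ℂ) ^ 2 + (Real.cos θ : ℝ) ^ 2 = 1 := by exact_mod_cast this
      linear_combination h' - (Real.sin θ : ℂ) ^ 2 * Complex.I_sq
    have hrot : ∀ y : UnitSphere, f j ((axisRotation θ).onUnitSphere y) =
        ζ⁻¹ ^ n * ζ ^ j * f j y := by
      intro y
      have he : e ((axisRotation θ).onUnitSphere y) = e y := by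
        simp [e, axisRotation_apply]
      have hb : b ((axisRotation θ).onUnitSphere y) = ζ * b y := by
        simp only [b, LinearIsometryEquiv.coe_onUnitSphere, axisRotation_apply, hζ]
        simp
        linear_combination (-(Complex.sin θ * (y : Space3) 1 * ((a 0 - Complex.I * a 1) / 2))) *
          Complex.I_sq
      have hc : c ((axisRotation θ).onUnitSphere y) = ζ⁻¹ * c y := by
        simp only [c, LinearIsometryEquiv.coe_onUnitSphere, axisRotation_apply, hζi]
        simp
        linear_combination (-(Complex.sin θ * (y : Space3) 1 * ((a 0 + Complex.I * a 1) / 2))) *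
          Complex.I_sq
      have hp : C (e y) * X + C (ζ * b y) * X ^ 2 + C (ζ⁻¹ * c y) =
          C ζ⁻¹ * (C (e y) * X + C (b y) * X ^ 2 + C (c y)).comp (C ζ * X) := by
        have h1 : (C ζ⁻¹ * C ζ : ℂ[X]) = 1 := by rw [← C_mul, inv_mul_cancel₀ hζ0, C_1]
        simp only [add_comp, mul_comp, C_comp, X_comp, pow_comp, C_mul]
        linear_combination (-(C (e y) * X + C (b y) * C ζ * X ^ 2)) * h1
      simp only [f, he, hb, hc]
      rw [hp, mul_pow, ← pow_comp, ← C_pow, coeff_C_mul, comp_C_mul_X_coeff]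
      ring
    have hinv := (axisRotation θ).measurePreserving_onUnitSphere.integral_comp
      (axisRotation θ).measurableEmbedding_onUnitSphere
      (fun y : UnitSphere => F ((y : Space3) 2) * f j y)
    have hcoord : ∀ y : UnitSphere, ((axisRotation θ).onUnitSphere y : Space3) 2 = (y : Space3) 2 := by
      intro y; simp [axisRotation_apply]
    simp only [hrot, hcoord, mul_left_comm _ (ζ⁻¹ ^ n * ζ ^ j), integral_const_mul] at hinv
    by_contra hne
    have h1 : ζ⁻¹ ^ n * ζ ^ j = 1 := by
      apply mul_right_cancel₀ hne
      rw [hinv, one_mul]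
    have h2 : ζ ^ j = ζ ^ n := by
      rw [inv_pow] at h1
      exact (inv_mul_eq_one₀ (pow_ne_zero _ hζ0)).mp h1 |>.symm
    exact hjn (hprim.pow_inj (Finset.mem_range.mp hj) (by omega) h2)
  simp only [hexp, Finset.mul_sum]
  rw [integral_finsetSum _ fun j _ => hint j, Finset.sum_eq_single n hzero
    (fun h => absurd (Finset.mem_range.mpr (by omega)) h)]
  simp only [hcenter]
  have hFP : IntegrableOn (fun t => F t * ((legendreP n).eval t : ℝ)) (Set.Icc (-1) 1) := by
    refine IntegrableOn.mul_continuousOn hF ?_ isCompact_Icc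
    exact (Complex.continuous_ofReal.comp (legendreP n).continuous).continuousOn
  rw [← integral_comp_coord_toSphere hFP, ← integral_mul_const]
  congr 1; ext y; ring

open scoped RealInnerProductSpace in
theorem UnitSphere.exists_linearIsometryEquiv (x : UnitSphere) :
    ∃ U : Space3 ≃ₗᵢ[ℝ] Space3, ∀ y : Space3, ⟪(x : Space3), U y⟫ = y 2 := by
  let e : Space3 := EuclideanSpace.single 2 1
  have hex : ‖e‖ = ‖(x : Space3)‖ := by simp [e]
  -- The reflection in the plane orthogonal to e - x carries e to x.
  obtain ⟨R, hR⟩ : ∃ R : Space3 ≃ₗᵢ[ℝ] Space3, R e = x := ⟨_, Submodule.reflection_sub hex⟩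
  refine ⟨R, fun y => ?_⟩
  rw [← hR, LinearIsometryEquiv.inner_map_map]
  simp [e, EuclideanSpace.inner_single_left]

open scoped RealInnerProductSpace in
theorem integrable_comp_inner_toSphere {F : ℝ → ℂ} (hF : IntegrableOn F (Set.Icc (-1) 1))
    (x : UnitSphere) :
    Integrable (fun y : UnitSphere => F ⟪(x : Space3), (y : Space3)⟫)
      (volume : Measure Space3).toSphere := by
  obtain ⟨U, hU⟩ := x.exists_linearIsometryEquiv
  rw [← U.measurePreserving_onUnitSphere.integrable_comp_emb U.measurableEmbedding_onUnitSphere]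
  simpa [Function.comp_def, hU] using integrable_comp_coord_toSphere hF

open scoped RealInnerProductSpace in
-- By the hat-box theorem a single level of a coordinate is null. Hence the pole y = x can be
-- ignored in the principal value.
theorem ae_inner_ne_one (x : UnitSphere) :
    ∀ᵐ y : UnitSphere ∂(volume : Measure Space3).toSphere, ⟪(x : Space3), (y : Space3)⟫ ≠ 1 := by
  obtain ⟨U, hU⟩ := x.exists_linearIsometryEquiv
  have hm : Continuous (fun y : UnitSphere => (y : Space3) 2) := by fun_prop
  have h1 : ∀ᵐ y : UnitSphere ∂(volume : Measure Space3).toSphere, (y : Space3) 2 ≠ 1 := by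
    have h : ∀ᵐ t : ℝ ∂((volume : Measure Space3).toSphere.map
        (fun y : UnitSphere => (y : Space3) 2)), t ≠ 1 := by
      rw [map_coord_toSphere]
      exact Measure.ae_smul_measure (Measure.ae_ne _ _) _
    exact ae_of_ae_map hm.aemeasurable h
  have h2 := U.symm.measurePreserving_onUnitSphere.quasiMeasurePreserving.ae h1
  filter_upwards [h2] with y hy
  rw [← hU] at hy
  simpa using hy

open scoped RealInnerProductSpace in
/-- The Funk–Hecke formula for powers of isotropic linear forms. -/
theorem funkHecke_isotropic {F : ℝ → ℂ} (hF : IntegrableOn F (Set.Icc (-1) 1)) (n : ℕ)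
    (p q : Space3) (hpq : ‖p‖ = ‖q‖) (horth : ⟪p, q⟫ = 0) (x : UnitSphere) :
    ∫ y : UnitSphere, F ⟪(x : Space3), (y : Space3)⟫ *
        ((⟪p, (y : Space3)⟫ : ℝ) + Complex.I * (⟪q, (y : Space3)⟫ : ℝ)) ^ n
        ∂(volume : Measure Space3).toSphere =
      (2 * Real.pi * ∫ t in Set.Icc (-1 : ℝ) 1, F t * ((legendreP n).eval t : ℝ)) *
        ((⟪p, (x : Space3)⟫ : ℝ) + Complex.I * (⟪q, (x : Space3)⟫ : ℝ)) ^ n := by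
  obtain ⟨U, hU⟩ := x.exists_linearIsometryEquiv
  have hswap : ∀ v w : Space3, ⟪v, U w⟫ = ⟪U.symm v, w⟫ := by
    intro v w
    rw [← U.inner_map_map (U.symm v) w, U.apply_symm_apply]
  have hx2 : ∀ v : Space3, ⟪v, (x : Space3)⟫ = (U.symm v) 2 := by
    intro v
    rw [← hU, U.apply_symm_apply, real_inner_comm]
  have hexp : ∀ v w : Space3, ⟪v, w⟫ = v 0 * w 0 + v 1 * w 1 + v 2 * w 2 := by
    intro v w
    rw [PiLp.inner_apply, Fin.sum_univ_three]
    simp only [RCLike.inner_apply, conj_trivial]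
    ring
  let P := U.symm p
  let Q := U.symm q
  have hPQ : ⟪P, P⟫ = ⟪Q, Q⟫ := by
    rw [real_inner_self_eq_norm_sq, real_inner_self_eq_norm_sq]
    simp [P, Q, hpq]
  have hO : ⟪P, Q⟫ = 0 := by simp [P, Q, horth]
  have h := funkHecke_isotropic_pole hF n (fun i => (P i : ℂ) + Complex.I * Q i) (by
    rw [hexp, hexp] at hPQ
    rw [hexp] at hO
    have h1 := congrArg Complex.ofReal hPQ
    have h2 := congrArg Complex.ofReal hO
    push_cast at h1 h2
    linear_combination h1 + 2 * Complex.I * h2 +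
      ((Q 0 : ℂ) ^ 2 + (Q 1 : ℂ) ^ 2 + (Q 2 : ℂ) ^ 2) * Complex.I_sq)
  rw [hx2, hx2]
  rw [← h, ← U.measurePreserving_onUnitSphere.integral_comp U.measurableEmbedding_onUnitSphere]
  congr 1; ext y
  rw [U.coe_onUnitSphere, hU, hswap, hswap, hexp, hexp]
  congr 2
  push_cast
  simp only [P, Q]
  ring

theorem eq_zero_of_forall_sum_mul_pow_eq_zero {N : ℕ} {c : ℕ → ℂ}
    (h : ∀ w : ℝ, ∑ j ∈ Finset.range N, c j * (w : ℂ) ^ j = 0) {j : ℕ} (hj : j < N) : c j = 0 := by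
  open Polynomial in
  let P : ℂ[X] := ∑ j ∈ Finset.range N, C (c j) * X ^ j
  have hP : P = 0 := by
    apply eq_zero_of_infinite_isRoot
    refine (Set.infinite_range_of_injective Complex.ofReal_injective).mono ?_
    rintro _ ⟨w, rfl⟩
    simp [P, IsRoot, eval_finsetSum, h]
  have hc : P.coeff j = c j := by
    simp only [P, finsetSum_coeff, coeff_C_mul, coeff_X_pow]
    simp [hj]
  rw [← hc, hP, coeff_zero]

open scoped RealInnerProductSpace in
/-- The Funk–Hecke formula for the (unnormalised) spherical harmonics; `s = 1` and `s = -1` give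
negative and positive orders. -/
theorem funkHecke_associatedLegendre {F : ℝ → ℂ} (hF : IntegrableOn F (Set.Icc (-1) 1))
    (n μ : ℕ) (hμ : μ ≤ n) (s : ℝ) (hs : s ^ 2 = 1) (x : UnitSphere) :
    ∫ y : UnitSphere, F ⟪(x : Space3), (y : Space3)⟫ *
        ((((y : Space3) 0 : ℝ) - s * Complex.I * ((y : Space3) 1 : ℝ)) ^ μ *
          ((Polynomial.derivative^[μ] (legendreP n)).eval ((y : Space3) 2) : ℝ))
        ∂(volume : Measure Space3).toSphere =
      (2 * Real.pi * ∫ t in Set.Icc (-1 : ℝ) 1, F t * ((legendreP n).eval t : ℝ)) *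
        ((((x : Space3) 0 : ℝ) - s * Complex.I * ((x : Space3) 1 : ℝ)) ^ μ *
          ((Polynomial.derivative^[μ] (legendreP n)).eval ((x : Space3) 2) : ℝ)) := by
  open Polynomial in
  let b : UnitSphere → ℂ := fun y => ((y : Space3) 0 - s * Complex.I * (y : Space3) 1) / 2
  let c : UnitSphere → ℂ := fun y => -((y : Space3) 0 + s * Complex.I * (y : Space3) 1) / 2
  let e : UnitSphere → ℂ := fun y => ((y : Space3) 2 : ℝ)
  let f : ℕ → UnitSphere → ℂ := fun j y => ((C (e y) * X + C (b y) * X ^ 2 + C (c y)) ^ n).coeff j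
  have hf : ∀ j, Continuous (f j) := fun j =>
    continuous_coeff_quadratic_pow (by fun_prop) (by fun_prop) (by fun_prop) n j
  have hint : ∀ j, Integrable (fun y : UnitSphere => F ⟪(x : Space3), (y : Space3)⟫ * f j y)
      (volume : Measure Space3).toSphere := fun j =>
    (integrable_comp_inner_toSphere hF x).mul_continuous_of_compact (hf j)
  -- A curve of isotropic vectors p + iq, quadratic in w: the form is w·y₂ + w²·b + c with 4bc = y₂²
  -- - 1 on the sphere. Its n-th power is a polynomial in w whose coefficient at w^{n+μ} is a
  -- multiple of the desired harmonic.
  let p : ℝ → Space3 := fun w => !₂[(w ^ 2 - 1) / 2, 0, w]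
  let q : ℝ → Space3 := fun w => !₂[0, -(s * (w ^ 2 + 1) / 2), 0]
  have hpq : ∀ w, ‖p w‖ = ‖q w‖ := by
    intro w
    simp only [EuclideanSpace.norm_eq, Fin.sum_univ_three, Real.norm_eq_abs, sq_abs, p, q]
    congr 1
    simp
    linear_combination -(w ^ 2 + 1) ^ 2 / 4 * hs
  have horth : ∀ w, ⟪p w, q w⟫ = 0 := by
    intro w
    rw [PiLp.inner_apply, Fin.sum_univ_three]
    simp [p, q]
  have hform : ∀ w, ∀ y : UnitSphere,
      ((⟪p w, (y : Space3)⟫ : ℝ) + Complex.I * (⟪q w, (y : Space3)⟫ : ℝ)) ^ n =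
        ∑ j ∈ Finset.range (2 * n + 1), f j y * (w : ℂ) ^ j := by
    intro w y
    rw [← eval_quadratic_pow_eq_sum]
    congr 1
    rw [PiLp.inner_apply, PiLp.inner_apply, Fin.sum_univ_three, Fin.sum_univ_three]
    simp [p, q, b, c, e]
    ring
  let L : ℂ := 2 * Real.pi * ∫ t in Set.Icc (-1 : ℝ) 1, F t * ((legendreP n).eval t : ℝ)
  -- The isotropic formula holds for every real w with the same scalar L, so it holds for each
  -- coefficient of w^j.
  have hcoeff : ∀ j < 2 * n + 1, ∫ y : UnitSphere, F ⟪(x : Space3), (y : Space3)⟫ * f j y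
      ∂(volume : Measure Space3).toSphere - L * f j x = 0 := by
    intro j hj
    refine eq_zero_of_forall_sum_mul_pow_eq_zero (N := 2 * n + 1)
      (c := fun j => ∫ y : UnitSphere, F ⟪(x : Space3), (y : Space3)⟫ * f j y
        ∂(volume : Measure Space3).toSphere - L * f j x) (fun w => ?_) hj
    have h := funkHecke_isotropic hF n (p w) (q w) (hpq w) (horth w) x
    simp only [hform, Finset.mul_sum] at h
    simp only [← mul_assoc] at h
    rw [integral_finsetSum _ fun j _ => (hint j).mul_const _] at h
    simp only [integral_mul_const] at h
    simp only [sub_mul, Finset.sum_sub_distrib, sub_eq_zero]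
    exact h
  have hval : ∀ y : UnitSphere, f (n + μ) y = ((n ! : ℂ) / ((n + μ)! : ℂ)) *
      ((((y : Space3) 0 : ℝ) - s * Complex.I * ((y : Space3) 1 : ℝ)) ^ μ *
          ((Polynomial.derivative^[μ] (legendreP n)).eval ((y : Space3) 2) : ℝ)) := by
    intro y
    have h1 : (((y : Space3) 0 : ℝ) : ℂ) ^ 2 + ((y : Space3) 1 : ℝ) ^ 2 + ((y : Space3) 2 : ℝ) ^ 2
        = 1 := by
      have := congrArg Complex.ofReal y.sum_sq_coord
      push_cast at this
      exact this
    have h2 : (s : ℂ) ^ 2 = 1 := by exact_mod_cast hs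
    simp only [f]
    rw [coeff_isotropic_pow n μ ((y : Space3) 2) (b y) (c y)]
    · simp only [b]; ring
    · simp only [b, c]
      linear_combination -h1 + (((y : Space3) 1 : ℝ) : ℂ) ^ 2 * Complex.I ^ 2 * h2 +
        (((y : Space3) 1 : ℝ) : ℂ) ^ 2 * Complex.I_sq
  have h := hcoeff (n + μ) (by omega)
  simp only [hval, mul_left_comm _ ((n ! : ℂ) / ((n + μ)! : ℂ)), integral_const_mul, ← mul_sub] at h
  have hne : ((n ! : ℂ) / ((n + μ)! : ℂ)) ≠ 0 := by
    apply div_ne_zero <;> exact_mod_cast Nat.factorial_ne_zero _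
  exact sub_eq_zero.mp ((mul_eq_zero.mp h).resolve_left hne)

theorem continuous_sphericalHarmonicY (n : ℕ) (m : ℤ) : Continuous (sphericalHarmonicY n m) := by
  unfold sphericalHarmonicY azimuthalFactor
  have := (Polynomial.derivative^[m.natAbs] (legendreP n)).continuous
  split_ifs <;> fun_prop

open scoped RealInnerProductSpace in
/-- The Funk–Hecke formula: a zonal integral operator acts on the spherical harmonics of degree
`n` as multiplication by a constant. -/
theorem funkHecke_sphericalHarmonicY {F : ℝ → ℂ} (hF : IntegrableOn F (Set.Icc (-1) 1))
    (n : ℕ) (m : ℤ) (hm : |m| ≤ (n : ℤ)) (x : UnitSphere) :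
    ∫ y : UnitSphere, F ⟪(x : Space3), (y : Space3)⟫ * sphericalHarmonicY n m y
        ∂(volume : Measure Space3).toSphere =
      (2 * Real.pi * ∫ t in Set.Icc (-1 : ℝ) 1, F t * ((legendreP n).eval t : ℝ)) *
        sphericalHarmonicY n m x := by
  have hμ : m.natAbs ≤ n := by rw [Int.abs_eq_natAbs] at hm; exact_mod_cast hm
  obtain ⟨s, hs, hY⟩ : ∃ s : ℝ, s ^ 2 = 1 ∧ ∀ y : UnitSphere,
      azimuthalFactor m (y : Space3) =
        (((y : Space3) 0 : ℝ) - s * Complex.I * ((y : Space3) 1 : ℝ)) ^ m.natAbs := by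
    by_cases h : 0 ≤ m
    · exact ⟨-1, by norm_num, fun y => by simp [azimuthalFactor, h]⟩
    · exact ⟨1, by norm_num, fun y => by simp [azimuthalFactor, h]⟩
  have h := funkHecke_associatedLegendre hF n m.natAbs hμ s hs x
  let N : ℂ := ((Real.sqrt ((2 * (n : ℝ) + 1) / (4 * Real.pi) *
      (((n - m.natAbs)! : ℝ) / ((n + m.natAbs)! : ℝ))) : ℝ) : ℂ)
  have hN : ∀ y : UnitSphere, sphericalHarmonicY n m y = N *
      ((((y : Space3) 0 : ℝ) - s * Complex.I * ((y : Space3) 1 : ℝ)) ^ m.natAbs *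
          ((Polynomial.derivative^[m.natAbs] (legendreP n)).eval ((y : Space3) 2) : ℝ)) := by
    intro y
    rw [sphericalHarmonicY, hY]
    simp only [N]
    ring
  simp only [hN, mul_left_comm _ N, integral_const_mul, h]

/-! ### Hypergeometric series with odd parameter -/

theorem HasSum.of_forall_eq {f g : ℕ → ℂ} {a : ℂ} (h : HasSum f a) (hfg : ∀ l, f l = g l) :
    HasSum g a := funext hfg ▸ h

/-- The coefficients of the hypergeometric series `∑ (-z/2)^l / (l! a(a+2)⋯(a+2l-2))` with odd
parameter `a = 2b + 1`. -/
noncomputable def oddHypCoeff (b : ℤ) (l : ℕ) : ℂ :=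
  (-1) ^ l / (2 ^ l * (l ! : ℂ) * ∏ i ∈ Finset.range l, (2 * (b : ℂ) + 1 + 2 * (i : ℂ)))

/-- The hypergeometric function `∑ (-z/2)^l / (l! a(a+2)⋯(a+2l-2))` with odd parameter
`a = 2b + 1`. -/
noncomputable def oddHyp (b : ℤ) (z : ℂ) : ℂ := ∑' l : ℕ, oddHypCoeff b l * z ^ l

/-- Odd integers never vanish, so no denominator of the series is zero even for b < 0. This lets one
series serve both j_n (b = n + 1) and y_n (b = -n). -/
theorem one_le_norm_odd (b : ℤ) : 1 ≤ ‖2 * (b : ℂ) + 1‖ := by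
  have h : (2 * (b : ℂ) + 1) = ((2 * b + 1 : ℤ) : ℂ) := by push_cast; ring
  rw [h, Complex.norm_intCast, ← Int.cast_abs]
  exact_mod_cast Int.one_le_abs (by omega)

theorem odd_ne_zero (b : ℤ) : 2 * (b : ℂ) + 1 ≠ 0 := by
  intro h
  have := one_le_norm_odd b
  rw [h, norm_zero] at this
  linarith

theorem oddHyp_prod_ne_zero (b : ℤ) (l : ℕ) :
    ∏ i ∈ Finset.range l, (2 * (b : ℂ) + 1 + 2 * (i : ℂ)) ≠ 0 := by
  refine Finset.prod_ne_zero_iff.mpr fun i _ => ?_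
  have h := odd_ne_zero (b + i)
  push_cast at h
  rwa [mul_add, add_right_comm] at h

theorem norm_oddHypCoeff_le (b : ℤ) (l : ℕ) : ‖oddHypCoeff b l‖ ≤ 1 / (2 ^ l * (l ! : ℝ)) := by
  have hp : 1 ≤ ‖∏ i ∈ Finset.range l, (2 * (b : ℂ) + 1 + 2 * (i : ℂ))‖ := by
    rw [norm_prod]
    rw [← Finset.prod_const_one (s := Finset.range l)]
    refine Finset.prod_le_prod (fun _ _ => zero_le_one) fun i _ => ?_
    have h := one_le_norm_odd (b + i)
    push_cast at h
    rwa [mul_add, add_right_comm] at h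
  rw [oddHypCoeff, norm_div, norm_pow, norm_neg, norm_one, one_pow, norm_mul, norm_mul, norm_pow,
    Complex.norm_natCast, Complex.norm_ofNat]
  have h0 : (0 : ℝ) < 2 ^ l * (l ! : ℝ) := by positivity
  exact one_div_le_one_div_of_le h0 (le_mul_of_one_le_right h0.le hp)

theorem summable_oddHyp (b : ℤ) (z : ℂ) : Summable fun l : ℕ => oddHypCoeff b l * z ^ l := by
  refine Summable.of_norm_bounded (Real.summable_pow_div_factorial (‖z‖ / 2)) fun l => ?_
  rw [norm_mul, norm_pow]
  calc ‖oddHypCoeff b l‖ * ‖z‖ ^ l ≤ 1 / (2 ^ l * (l ! : ℝ)) * ‖z‖ ^ l := by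
        gcongr; exact norm_oddHypCoeff_le b l
    _ = (‖z‖ / 2) ^ l / (l ! : ℝ) := by rw [div_pow]; field_simp

theorem hasSum_oddHyp (b : ℤ) (z : ℂ) :
    HasSum (fun l : ℕ => oddHypCoeff b l * z ^ l) (oddHyp b z) := (summable_oddHyp b z).hasSum

/-- Splitting off the first factor 2b + 1 of the product shifts b to b + 1; summed, this is the
derivative rule. -/
theorem succ_mul_oddHypCoeff_succ (b : ℤ) (l : ℕ) :
    oddHypCoeff b (l + 1) * ((l : ℂ) + 1) =
      -(1 / (2 * (2 * (b : ℂ) + 1))) * oddHypCoeff (b + 1) l := by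
  have h1 : ∏ i ∈ Finset.range (l + 1), (2 * (b : ℂ) + 1 + 2 * (i : ℂ)) =
      (∏ i ∈ Finset.range l, (2 * ((b + 1 : ℤ) : ℂ) + 1 + 2 * (i : ℂ))) * (2 * (b : ℂ) + 1) := by
    rw [Finset.prod_range_succ']
    congr 1
    · refine Finset.prod_congr rfl fun i _ => ?_
      push_cast; ring
    · simp
  have h2 := oddHyp_prod_ne_zero (b + 1) l
  have h3 := odd_ne_zero b
  have h4 : (l ! : ℂ) ≠ 0 := by exact_mod_cast Nat.factorial_ne_zero _
  have h5 : (l : ℂ) + 1 ≠ 0 := by exact_mod_cast Nat.succ_ne_zero l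
  rw [oddHypCoeff, oddHypCoeff, h1, Nat.factorial_succ]
  push_cast at h2 ⊢
  field_simp
  ring

/-- The products for b and b + 1 differ only in their end factors 2b + 1 and 2b + 1 + 2l. -/
theorem oddHypCoeff_contiguous (b : ℤ) (l : ℕ) :
    (2 * (l : ℂ) + (2 * (b : ℂ) + 1)) * oddHypCoeff (b + 1) l =
      (2 * (b : ℂ) + 1) * oddHypCoeff b l := by
  have h1 : (∏ i ∈ Finset.range l, (2 * (b : ℂ) + 1 + 2 * (i : ℂ))) * (2 * (b : ℂ) + 1 + 2 * l) =
      (∏ i ∈ Finset.range l, (2 * ((b + 1 : ℤ) : ℂ) + 1 + 2 * (i : ℂ))) * (2 * (b : ℂ) + 1) := by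
    rw [← Finset.prod_range_succ, Finset.prod_range_succ']
    congr 1
    · refine Finset.prod_congr rfl fun i _ => ?_
      push_cast; ring
    · simp
  have h2 := oddHyp_prod_ne_zero (b + 1) l
  have h3 := oddHyp_prod_ne_zero b l
  have h4 : (l ! : ℂ) ≠ 0 := by exact_mod_cast Nat.factorial_ne_zero _
  rw [oddHypCoeff, oddHypCoeff]
  rw [mul_div_assoc', mul_div_assoc', div_eq_div_iff (mul_ne_zero (mul_ne_zero (by simp) h4) h2)
    (mul_ne_zero (mul_ne_zero (by simp) h4) h3)]
  linear_combination ((-1) ^ l * (2 ^ l * (l ! : ℂ))) * h1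

theorem hasDerivAt_oddHyp (b : ℤ) (z : ℂ) :
    HasDerivAt (oddHyp b) (-(1 / (2 * (2 * (b : ℂ) + 1))) * oddHyp (b + 1) z) z := by
  let R : ℝ := ‖z‖ + 1
  have hR : 1 ≤ R := by simp [R]
  have hz : z ∈ ball (0 : ℂ) R := by simp [R]
  have h := hasDerivAt_tsum_of_isPreconnected (𝕜 := ℂ) (F := ℂ)
    (g := fun l w => oddHypCoeff b l * w ^ l)
    (g' := fun l w => oddHypCoeff b l * ((l : ℂ) * w ^ (l - 1)))
    (Real.summable_pow_div_factorial R) isOpen_ball (convex_ball (0 : ℂ) R).isPreconnected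
    (fun l w _ => (hasDerivAt_pow l w).const_mul _)
    (fun l w hw => by
      have hw' : ‖w‖ ≤ R := by simpa using (mem_ball.mp hw).le
      -- The factor l from differentiation is absorbed by the 2^{-l} in the coefficient bound.
      have h1 : (l : ℝ) ≤ 2 ^ l := by exact_mod_cast (Nat.lt_two_pow_self (n := l)).le
      have h2 : ‖w‖ ^ (l - 1) ≤ R ^ l :=
        (pow_le_pow_left₀ (norm_nonneg _) hw' _).trans (pow_le_pow_right₀ hR (by omega))
      rw [norm_mul, norm_mul, norm_pow, Complex.norm_natCast]
      calc ‖oddHypCoeff b l‖ * ((l : ℝ) * ‖w‖ ^ (l - 1))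
          ≤ 1 / (2 ^ l * (l ! : ℝ)) * (2 ^ l * R ^ l) := by
            gcongr; exact norm_oddHypCoeff_le b l
        _ = R ^ l / (l ! : ℝ) := by field_simp)
    hz (summable_oddHyp b z) hz
  have hd : ∑' l : ℕ, oddHypCoeff b l * ((l : ℂ) * z ^ (l - 1)) =
      -(1 / (2 * (2 * (b : ℂ) + 1))) * oddHyp (b + 1) z := by
    have h1 := (hasSum_oddHyp (b + 1) z).mul_left (-(1 / (2 * (2 * (b : ℂ) + 1))))
    have h2 : HasSum (fun l : ℕ => oddHypCoeff b (l + 1) * (((l + 1 : ℕ) : ℂ) * z ^ (l + 1 - 1)))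
        (-(1 / (2 * (2 * (b : ℂ) + 1))) * oddHyp (b + 1) z) := by
      refine h1.of_forall_eq fun l => ?_
      rw [← mul_assoc, ← mul_assoc, ← succ_mul_oddHypCoeff_succ]
      push_cast
      simp
    have h3 := (hasSum_nat_add_iff 1
      (f := fun l : ℕ => oddHypCoeff b l * ((l : ℂ) * z ^ (l - 1)))).mp h2
    simpa using h3.tsum_eq
  rw [hd] at h
  exact h

theorem oddHyp_contiguous (b : ℤ) (z : ℂ) :
    2 * z * deriv (oddHyp (b + 1)) z + (2 * (b : ℂ) + 1) * oddHyp (b + 1) z =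
      (2 * (b : ℂ) + 1) * oddHyp b z := by
  have h0 : HasSum (fun l : ℕ => (l : ℂ) * oddHypCoeff (b + 1) l * z ^ l)
      (z * deriv (oddHyp (b + 1)) z) := by
    rw [(hasDerivAt_oddHyp (b + 1) z).deriv]
    have h1 := ((hasSum_oddHyp (b + 1 + 1) z).mul_left
      (-(1 / (2 * (2 * ((b + 1 : ℤ) : ℂ) + 1))))).mul_left z
    have h2 : HasSum (fun l : ℕ => ((l + 1 : ℕ) : ℂ) * oddHypCoeff (b + 1) (l + 1) * z ^ (l + 1))
        (z * (-(1 / (2 * (2 * ((b + 1 : ℤ) : ℂ) + 1))) * oddHyp (b + 1 + 1) z)) := by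
      refine h1.of_forall_eq fun l => ?_
      rw [← mul_assoc (-(1 / (2 * (2 * ((b + 1 : ℤ) : ℂ) + 1)))), ← succ_mul_oddHypCoeff_succ]
      push_cast
      ring
    have h3 := (hasSum_nat_add_iff 1
      (f := fun l : ℕ => (l : ℂ) * oddHypCoeff (b + 1) l * z ^ l)).mp h2
    simpa using h3
  have h1 := (h0.mul_left 2).add ((hasSum_oddHyp (b + 1) z).mul_left (2 * (b : ℂ) + 1))
  have h2 := (hasSum_oddHyp b z).mul_left (2 * (b : ℂ) + 1)
  rw [mul_assoc]
  refine h1.unique (h2.of_forall_eq fun l => ?_)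
  rw [← mul_assoc, ← oddHypCoeff_contiguous]
  ring

theorem oddHyp_zero_sq (k : ℂ) : oddHyp 0 (k ^ 2) = Complex.cos k := by
  refine (hasSum_oddHyp 0 (k ^ 2)).unique ?_
  refine (Complex.hasSum_cos k).of_forall_eq fun l => ?_
  have h : (2 : ℂ) ^ l * (l ! : ℂ) * ∏ i ∈ Finset.range l, (2 * ((0 : ℤ) : ℂ) + 1 + 2 * (i : ℂ)) =
      ((2 * l)! : ℂ) := by
    induction l with
    | zero => simp
    | succ l ih =>
      rw [Finset.prod_range_succ, show 2 * (l + 1) = 2 * l + 1 + 1 by ring, Nat.factorial_succ,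
        Nat.factorial_succ, Nat.factorial_succ]
      push_cast
      rw [← ih]
      push_cast
      ring
  rw [oddHypCoeff, h, ← pow_mul]
  ring

theorem mul_oddHyp_one_sq (k : ℂ) : k * oddHyp 1 (k ^ 2) = Complex.sin k := by
  refine ((hasSum_oddHyp 1 (k ^ 2)).mul_left k).unique ?_
  refine (Complex.hasSum_sin k).of_forall_eq fun l => ?_
  have h : (2 : ℂ) ^ l * (l ! : ℂ) * ∏ i ∈ Finset.range l, (2 * ((1 : ℤ) : ℂ) + 1 + 2 * (i : ℂ)) =
      ((2 * l + 1)! : ℂ) := by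
    induction l with
    | zero => simp
    | succ l ih =>
      rw [Finset.prod_range_succ, show 2 * (l + 1) + 1 = 2 * l + 1 + 1 + 1 by ring,
        Nat.factorial_succ (2 * l + 1 + 1), Nat.factorial_succ (2 * l + 1), Nat.factorial_succ l]
      push_cast
      rw [← ih]
      push_cast
      ring
  rw [oddHypCoeff, h, ← pow_mul]
  ring

/-! ### Entire normalisations of the spherical Bessel functions, ladder relations, Wronskian -/

/-- The entire function `k ↦ k^(-n) j_n(k)`. -/
noncomputable def besselA (n : ℕ) (k : ℂ) : ℂ :=
  (((2 * n + 1)‼ : ℕ) : ℂ)⁻¹ * oddHyp (n + 1) (k ^ 2)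

/-- The entire function `k ↦ k^(n+1) y_n(k)`. -/
noncomputable def besselB (n : ℕ) (k : ℂ) : ℂ :=
  -(((2 * n)! : ℂ) / (2 ^ n * (n ! : ℂ))) * oddHyp (-n) (k ^ 2)

/-- The entire function `k ↦ k^(n+1) h_n^{(1)}(k)`. -/
noncomputable def besselH (n : ℕ) (k : ℂ) : ℂ :=
  k ^ (2 * n + 1) * besselA n k + Complex.I * besselB n k

theorem hasDerivAt_oddHyp_sq (b : ℤ) (k : ℂ) :
    HasDerivAt (fun w => oddHyp b (w ^ 2)) (-(k / (2 * (b : ℂ) + 1)) * oddHyp (b + 1) (k ^ 2)) k := by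
  have h := (hasDerivAt_oddHyp b (k ^ 2)).comp k (hasDerivAt_pow 2 k)
  refine h.congr_deriv ?_
  have := odd_ne_zero b
  field_simp
  norm_num
  ring

/-- This is (k^{-n} j_n)' = -k^{-n} j_{n+1}, in a form free of negative powers and valid at k = 0.
-/
theorem hasDerivAt_besselA (n : ℕ) (k : ℂ) :
    HasDerivAt (besselA n) (-k * besselA (n + 1) k) k := by
  refine ((hasDerivAt_oddHyp_sq (n + 1) k).const_mul _).congr_deriv ?_
  have h := odd_ne_zero (n + 1)
  have h1 : (((2 * n + 1)‼ : ℕ) : ℂ) ≠ 0 := by exact_mod_cast (Nat.doubleFactorial_pos _).ne'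
  rw [besselA, show 2 * (n + 1) + 1 = 2 * n + 1 + 2 by ring, Nat.doubleFactorial_add_two]
  push_cast at h ⊢
  rw [show (2 * (n : ℂ) + 1 + 2) = 2 * ((n : ℂ) + 1) + 1 by ring]
  field_simp

theorem besselA_eq (n : ℕ) (k : ℂ) :
    besselA n k = (2 * (n : ℂ) + 3) * besselA (n + 1) k - k ^ 2 * besselA (n + 2) k := by
  have h := oddHyp_contiguous (n + 1) (k ^ 2)
  rw [(hasDerivAt_oddHyp _ _).deriv] at h
  have h0 := odd_ne_zero (n + 1)
  have h2 := odd_ne_zero (n + 1 + 1)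
  have h1 : (((2 * n + 1)‼ : ℕ) : ℂ) ≠ 0 := by exact_mod_cast (Nat.doubleFactorial_pos _).ne'
  rw [besselA, besselA, besselA, show 2 * (n + 2) + 1 = 2 * n + 1 + 2 + 2 by ring,
    show 2 * (n + 1) + 1 = 2 * n + 1 + 2 by ring, Nat.doubleFactorial_add_two (2 * n + 1 + 2),
    Nat.doubleFactorial_add_two (2 * n + 1)]
  push_cast at h h0 h2 ⊢
  rw [show (n : ℤ) + 2 + 1 = n + 1 + 1 + 1 by ring]
  rw [show (2 * (n : ℂ) + 1 + 2 + 2) = 2 * ((n : ℂ) + 1 + 1) + 1 by ring,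
    show (2 * (n : ℂ) + 1 + 2) = 2 * ((n : ℂ) + 1) + 1 by ring,
    show (2 * (n : ℂ) + 3) = 2 * ((n : ℂ) + 1) + 1 by ring]
  field_simp at h ⊢
  linear_combination -h

theorem hasDerivAt_besselB (n : ℕ) (k : ℂ) :
    HasDerivAt (besselB (n + 1)) (k * besselB n k) k := by
  refine ((hasDerivAt_oddHyp_sq _ k).const_mul _).congr_deriv ?_
  have h := odd_ne_zero (-(n + 1))
  have h3 : 2 * (n : ℂ) + 1 ≠ 0 := by simpa using odd_ne_zero n
  have h4 : (n ! : ℂ) ≠ 0 := by exact_mod_cast Nat.factorial_ne_zero _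
  have h5 : (n : ℂ) + 1 ≠ 0 := by exact_mod_cast Nat.succ_ne_zero n
  rw [besselB, show 2 * (n + 1) = 2 * n + 1 + 1 by ring, Nat.factorial_succ, Nat.factorial_succ,
    Nat.factorial_succ]
  push_cast at h ⊢
  rw [show -((n : ℤ) + 1) + 1 = -n by ring]
  rw [show 2 * -((n : ℂ) + 1) + 1 = -(2 * n + 1) by ring] at h ⊢
  field_simp
  ring

/-- The contiguous relation at b = -(n + 1) links the series with parameters -n and -(n + 1); the
factorial prefactors absorb the constants. -/
theorem mul_deriv_besselB (n : ℕ) (k : ℂ) :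
    k * deriv (besselB n) k = (2 * (n : ℂ) + 1) * besselB n k - besselB (n + 1) k := by
  have hd : HasDerivAt (besselB n) (-(((2 * n)! : ℂ) / (2 ^ n * (n ! : ℂ))) *
    (-(k / (2 * ((-n : ℤ) : ℂ) + 1)) * oddHyp (-n + 1) (k ^ 2))) k :=
    (hasDerivAt_oddHyp_sq _ k).const_mul _
  have h := oddHyp_contiguous (-(n + 1)) (k ^ 2)
  rw [(hasDerivAt_oddHyp _ _).deriv] at h
  have h0 := odd_ne_zero (-n)
  have h4 : (n ! : ℂ) ≠ 0 := by exact_mod_cast Nat.factorial_ne_zero _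
  have h5 : (n : ℂ) + 1 ≠ 0 := by exact_mod_cast Nat.succ_ne_zero n
  rw [hd.deriv, besselB, besselB, show 2 * (n + 1) = 2 * n + 1 + 1 by ring, Nat.factorial_succ,
    Nat.factorial_succ, Nat.factorial_succ]
  rw [show -((n : ℤ) + 1) + 1 = -n by ring] at h
  push_cast at h h0 ⊢
  rw [show 2 * -((n : ℂ) + 1) + 1 = -(2 * n + 1) by ring] at h
  have h6 : k ^ 2 * (-(1 / (2 * -(n : ℂ) + 1))) * oddHyp (-n + 1) (k ^ 2) =
      (2 * (n : ℂ) + 1) * oddHyp (-n) (k ^ 2) - (2 * (n : ℂ) + 1) * oddHyp (-1 + -n) (k ^ 2) := by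
    rw [show (-1 + -(n : ℤ)) = -(n + 1) by ring]
    field_simp at h ⊢
    linear_combination h
  rw [show (-1 + -(n : ℤ)) = -(n + 1) by ring] at h6
  have h7 : k * (-((((2 * n)! : ℕ) : ℂ) / (2 ^ n * (n ! : ℂ))) *
      (-(k / (2 * -(n : ℂ) + 1)) * oddHyp (-n + 1) (k ^ 2))) =
      -((((2 * n)! : ℕ) : ℂ) / (2 ^ n * (n ! : ℂ))) *
      (k ^ 2 * (-(1 / (2 * -(n : ℂ) + 1))) * oddHyp (-n + 1) (k ^ 2)) := by ring
  rw [h7, h6]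
  field_simp
  ring

theorem differentiable_besselA (n : ℕ) : Differentiable ℂ (besselA n) :=
  fun k => (hasDerivAt_besselA n k).differentiableAt

theorem differentiable_besselB (n : ℕ) : Differentiable ℂ (besselB n) :=
  fun k => ((hasDerivAt_oddHyp_sq (-n) k).const_mul _).differentiableAt

theorem hasDerivAt_besselH_aux (n : ℕ) (k : ℂ) :
    HasDerivAt (besselH n) ((2 * (n : ℂ) + 1) * k ^ (2 * n) * besselA n k +
      k ^ (2 * n + 1) * (-k * besselA (n + 1) k) + Complex.I * deriv (besselB n) k) k := by
  have h1 := (hasDerivAt_pow (2 * n + 1) k).mul (hasDerivAt_besselA n k)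
  have h2 := (differentiable_besselB n k).hasDerivAt.const_mul Complex.I
  refine (h1.add h2).congr_deriv ?_
  rw [Nat.add_sub_cancel]
  push_cast
  ring

theorem hasDerivAt_besselH_succ (n : ℕ) (k : ℂ) :
    HasDerivAt (besselH (n + 1)) (k * besselH n k) k := by
  refine (hasDerivAt_besselH_aux (n + 1) k).congr_deriv ?_
  rw [(hasDerivAt_besselB n k).deriv, besselH]
  push_cast
  linear_combination (-(k ^ (2 * n + 2))) * besselA_eq n k

theorem mul_deriv_besselH (n : ℕ) (k : ℂ) :
    k * deriv (besselH n) k = (2 * (n : ℂ) + 1) * besselH n k - besselH (n + 1) k := by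
  rw [(hasDerivAt_besselH_aux n k).deriv, besselH, besselH]
  linear_combination Complex.I * mul_deriv_besselB n k

theorem differentiable_besselH (n : ℕ) : Differentiable ℂ (besselH n) :=
  fun k => (hasDerivAt_besselH_aux n k).differentiableAt

theorem besselH_add_two (n : ℕ) (k : ℂ) :
    besselH (n + 2) k = (2 * (n : ℂ) + 3) * besselH (n + 1) k - k ^ 2 * besselH n k := by
  have h := mul_deriv_besselH (n + 1) k
  rw [(hasDerivAt_besselH_succ n k).deriv] at h
  push_cast at h
  linear_combination h

theorem mul_besselA_zero (k : ℂ) : k * besselA 0 k = Complex.sin k := by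
  rw [← mul_oddHyp_one_sq]
  simp [besselA]

theorem besselA_zero_add (k : ℂ) :
    besselA 0 k + k * (-k * besselA 1 k) = Complex.cos k := by
  have h1 : HasDerivAt (fun w => w * besselA 0 w) (1 * besselA 0 k + k * (-k * besselA 1 k)) k :=
    (hasDerivAt_id k).mul (hasDerivAt_besselA 0 k)
  have h2 : (fun w => w * besselA 0 w) = Complex.sin := funext mul_besselA_zero
  rw [h2] at h1
  rw [← h1.unique (Complex.hasDerivAt_sin k)]
  ring

theorem besselH_zero (k : ℂ) : besselH 0 k = -Complex.I * Complex.exp (k * Complex.I) := by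
  have h1 := mul_besselA_zero k
  have h2 : besselB 0 k = -Complex.cos k := by
    rw [← oddHyp_zero_sq]
    simp [besselB]
  rw [besselH, h2, Complex.exp_mul_I]
  simp only [mul_zero, zero_add, pow_one, h1]
  linear_combination Complex.sin k * Complex.I_sq

theorem deriv_besselH_zero (k : ℂ) : deriv (besselH 0) k = Complex.exp (k * Complex.I) := by
  have h : besselH 0 = fun k => -Complex.I * Complex.exp (k * Complex.I) := funext besselH_zero
  have h1 : HasDerivAt (fun k : ℂ => -Complex.I * Complex.exp (k * Complex.I))
      (-Complex.I * (Complex.exp (k * Complex.I) * (1 * Complex.I))) k :=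
    (((hasDerivAt_id k).mul_const Complex.I).cexp).const_mul _
  rw [h, h1.deriv]
  linear_combination (-Complex.exp (k * Complex.I)) * Complex.I_sq

/-- The Wronskian of the spherical Bessel functions. -/
theorem besselA_mul_besselH_succ_sub (n : ℕ) (k : ℂ) :
    besselA n k * besselH (n + 1) k - k ^ 2 * besselA (n + 1) k * besselH n k = -Complex.I := by
  induction n with
  | zero =>
    have hA := mul_besselA_zero k
    have hA' := besselA_zero_add k
    have hH := mul_deriv_besselH 0 k
    rw [deriv_besselH_zero] at hH
    have hH0 := besselH_zero k
    have hexp := Complex.exp_mul_I k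
    have hcs := Complex.sin_sq_add_cos_sq k
    simp only [Nat.cast_zero, mul_zero, zero_add, one_mul] at hH ⊢
    have hH1 : besselH 1 k = besselH 0 k - k * Complex.exp (k * Complex.I) := by
      linear_combination hH
    rw [hH1, hH0, hexp]
    have hA1 : k ^ 2 * besselA 1 k = besselA 0 k - Complex.cos k := by linear_combination -hA'
    rw [hA1]
    linear_combination (-(Complex.cos k + Complex.sin k * Complex.I)) * hA - Complex.I * hcs -
      Complex.cos k * Complex.sin k * Complex.I_sq
  | succ n ih =>
    -- Both families obey the same three-term recurrence up to the normalising powers of k, so the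
    -- Wronskian expression does not depend on n.
    rw [besselH_add_two]
    linear_combination ih - besselH (n + 1) k * besselA_eq n k

theorem sphericalBesselJ_eq (n : ℕ) (k : ℂ) : sphericalBesselJ n k = k ^ n * besselA n k := by
  rw [sphericalBesselJ, besselA, oddHyp, ← mul_assoc, ← tsum_mul_left]
  congr 1; ext l
  have h : (((2 * n + 2 * l + 1)‼ : ℕ) : ℂ) = (((2 * n + 1)‼ : ℕ) : ℂ) *
      ∏ i ∈ Finset.range l, (2 * ((n + 1 : ℤ) : ℂ) + 1 + 2 * (i : ℂ)) := by
    induction l with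
    | zero => simp
    | succ l ih =>
      rw [Finset.prod_range_succ, ← mul_assoc, ← ih,
        show 2 * n + 2 * (l + 1) + 1 = 2 * n + 2 * l + 1 + 2 by ring, Nat.doubleFactorial_add_two]
      push_cast
      ring
  rw [h, oddHypCoeff, ← pow_mul, pow_add]
  have h1 : (((2 * n + 1)‼ : ℕ) : ℂ) ≠ 0 := by exact_mod_cast (Nat.doubleFactorial_pos _).ne'
  have h2 := oddHyp_prod_ne_zero (n + 1) l
  have h4 : (l ! : ℂ) ≠ 0 := by exact_mod_cast Nat.factorial_ne_zero _
  field_simp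

theorem sphericalNeumannY_eq (n : ℕ) {k : ℂ} (hk : k ≠ 0) :
    sphericalNeumannY n k = (k ^ (n + 1))⁻¹ * besselB n k := by
  rw [sphericalNeumannY, besselB, mul_left_comm, oddHyp, ← tsum_mul_left, ← tsum_mul_left,
    ← tsum_mul_left]
  refine tsum_congr fun l => ?_
  have h : ∏ i ∈ Finset.range l, (-2 * (n : ℂ) + 2 * (i : ℂ) + 1) =
      ∏ i ∈ Finset.range l, (2 * ((-n : ℤ) : ℂ) + 1 + 2 * (i : ℂ)) := by
    refine Finset.prod_congr rfl fun i _ => ?_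
    push_cast; ring
  have hz : k ^ (2 * (l : ℤ) - n - 1) = (k ^ (n + 1))⁻¹ * (k ^ 2) ^ l := by
    rw [← pow_mul, ← zpow_natCast, ← zpow_natCast, ← zpow_neg, ← zpow_add₀ hk]
    congr 1
    push_cast; ring
  rw [h, hz, oddHypCoeff]
  ring

theorem sphericalHankelH1_eq (n : ℕ) {k : ℂ} (hk : k ≠ 0) :
    sphericalHankelH1 n k = (k ^ (n + 1))⁻¹ * besselH n k := by
  rw [sphericalHankelH1, sphericalBesselJ_eq, sphericalNeumannY_eq n hk, besselH]
  have : k ^ (n + 1) ≠ 0 := pow_ne_zero _ hk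
  field_simp
  ring

theorem sq_mul_deriv_sphericalBesselJ_mul (n : ℕ) {k : ℂ} (hk : k ≠ 0) :
    k ^ 2 * deriv (sphericalBesselJ n) k * sphericalHankelH1 n k =
      n * besselA n k * besselH n k + k * deriv (besselA n) k * besselH n k := by
  have h1 : sphericalBesselJ n = fun k => k ^ n * besselA n k := funext (sphericalBesselJ_eq n)
  have h2 : HasDerivAt (fun k => k ^ n * besselA n k) _ k :=
    (hasDerivAt_pow n k).mul (differentiable_besselA n k).hasDerivAt
  rw [h1, h2.deriv, sphericalHankelH1_eq n hk]
  -- The derivative of k^n contains the truncated exponent n - 1, so n = 0 is separate.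
  rcases n with _ | n
  · simp; field_simp
  · rw [Nat.add_sub_cancel]
    field_simp
    ring

theorem sq_mul_sphericalBesselJ_mul_deriv (n : ℕ) {k : ℂ} (hk : k ≠ 0) :
    k ^ 2 * sphericalBesselJ n k * deriv (sphericalHankelH1 n) k =
      -((n : ℂ) + 1) * besselA n k * besselH n k + k * besselA n k * deriv (besselH n) k := by
  -- The product formula is available only away from 0, so the derivative is transferred through a
  -- neighbourhood of k.
  have h1 : sphericalHankelH1 n =ᶠ[𝓝 k] fun k => (k ^ (n + 1))⁻¹ * besselH n k := by
    filter_upwards [isOpen_ne.mem_nhds hk] with w hw using sphericalHankelH1_eq n hw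
  have h2 : HasDerivAt (fun k => (k ^ (n + 1))⁻¹ * besselH n k) _ k :=
    ((hasDerivAt_pow (n + 1) k).inv (pow_ne_zero _ hk)).mul (differentiable_besselH n k).hasDerivAt
  rw [h1.deriv_eq, h2.deriv, sphericalBesselJ_eq, Nat.add_sub_cancel]
  simp only [Pi.inv_apply]
  push_cast
  field_simp
  ring

/-! ### The radial integral as a product of Bessel functions -/

/-- The integral `∫₀² e^{ikr} P_n(1 - r²/2) dr`. -/
noncomputable def radialIntegral (n : ℕ) (k : ℂ) : ℂ :=
  ∫ r in (0 : ℝ)..2, Complex.exp (Complex.I * k * r) * ((legendreP n).eval (1 - r ^ 2 / 2) : ℝ)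

theorem continuous_legendreP_radial (n : ℕ) :
    Continuous fun r : ℝ => (((legendreP n).eval (1 - r ^ 2 / 2) : ℝ) : ℂ) :=
  Complex.continuous_ofReal.comp ((legendreP n).continuous.comp (by fun_prop))

theorem hasDerivAt_radialIntegral (n : ℕ) (k : ℂ) :
    HasDerivAt (radialIntegral n) (∫ r in (0 : ℝ)..2, Complex.exp (Complex.I * k * r) *
      (Complex.I * r) * ((legendreP n).eval (1 - r ^ 2 / 2) : ℝ)) k := by
  have hP := continuous_legendreP_radial n
  obtain ⟨C, hC⟩ := (isCompact_Icc (a := (0 : ℝ)) (b := 2)).exists_bound_of_continuousOn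
    hP.continuousOn
  refine (intervalIntegral.hasDerivAt_integral_of_dominated_loc_of_deriv_le
    (s := ball k 1) (bound := fun _ => Real.exp ((‖k‖ + 1) * 2) * 2 * C)
    (F := fun k (r : ℝ) => Complex.exp (Complex.I * k * r) *
      ((legendreP n).eval (1 - r ^ 2 / 2) : ℝ))
    (F' := fun k (r : ℝ) => Complex.exp (Complex.I * k * r) *
      (Complex.I * r) * ((legendreP n).eval (1 - r ^ 2 / 2) : ℝ))
    (ball_mem_nhds k one_pos) ?_ ?_ ?_ ?_ ?_ ?_).2
  · exact .of_forall fun w => (by fun_prop : Continuous fun r : ℝ => Complex.exp (Complex.I * w * r) *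
      ((legendreP n).eval (1 - r ^ 2 / 2) : ℝ)).aestronglyMeasurable
  · exact (by fun_prop : Continuous fun r : ℝ => Complex.exp (Complex.I * k * r) *
      ((legendreP n).eval (1 - r ^ 2 / 2) : ℝ)).intervalIntegrable _ _
  · exact (by fun_prop : Continuous fun r : ℝ => Complex.exp (Complex.I * k * r) *
      (Complex.I * r) * ((legendreP n).eval (1 - r ^ 2 / 2) : ℝ)).aestronglyMeasurable
  · refine .of_forall fun r hr w hw => ?_
    rw [Set.uIoc_of_le (by norm_num)] at hr
    have hr0 : 0 ≤ r := hr.1.le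
    have hw' : ‖w‖ ≤ ‖k‖ + 1 := by
      have h1 : ‖w - k‖ < 1 := by rwa [mem_ball, dist_eq_norm] at hw
      have h2 := norm_le_norm_add_norm_sub' w k
      linarith
    have h1 : ‖Complex.exp (Complex.I * w * r)‖ ≤ Real.exp ((‖k‖ + 1) * 2) := by
      refine (Complex.norm_exp_le_exp_norm _).trans (Real.exp_le_exp.mpr ?_)
      rw [norm_mul, norm_mul, Complex.norm_I, one_mul, Complex.norm_real, Real.norm_of_nonneg hr0]
      exact mul_le_mul hw' hr.2 hr0 (by positivity)
    have h2 : ‖Complex.I * (r : ℂ)‖ ≤ 2 := by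
      rw [norm_mul, Complex.norm_I, one_mul, Complex.norm_real, Real.norm_of_nonneg hr0]
      exact hr.2
    rw [norm_mul, norm_mul]
    have h3 := hC r ⟨hr0, hr.2⟩
    gcongr
  · exact intervalIntegrable_const
  · refine .of_forall fun r _ w _ => ?_
    have h1 : HasDerivAt (fun w : ℂ => Complex.I * w * r) (Complex.I * r) w := by
      simpa using ((hasDerivAt_id w).const_mul Complex.I).mul_const (r : ℂ)
    exact (h1.cexp).mul_const _

/-- The first order recurrence in the degree satisfied by the radial integrals. -/
theorem radialIntegral_recurrence (n : ℕ) (k : ℂ) :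
    k * deriv (radialIntegral (n + 1)) k + (2 * (n : ℂ) + 3) * radialIntegral (n + 1) k =
      (2 * (n : ℂ) + 1) * radialIntegral n k - k * deriv (radialIntegral n) k := by
  -- The recurrence is the integral of d/dr [r e^{ikr} P(1 - r²/2)]. With t = 1 - r²/2 the chain
  -- rule gives -r² P'(t) = 2(t - 1)P'(t) = 2(n + 1)(P_{n+1} - P_n).
  let P : Polynomial ℝ := legendreP (n + 1) + legendreP n
  have hderiv : ∀ r : ℝ, HasDerivAt
      (fun r : ℝ => (r : ℂ) * Complex.exp (Complex.I * k * r) * ((P.eval (1 - r ^ 2 / 2) : ℝ) : ℂ))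
      (k * (Complex.exp (Complex.I * k * r) * (Complex.I * r) *
          ((legendreP (n + 1)).eval (1 - r ^ 2 / 2) : ℝ)) +
        (2 * (n : ℂ) + 3) * (Complex.exp (Complex.I * k * r) *
          ((legendreP (n + 1)).eval (1 - r ^ 2 / 2) : ℝ)) -
        ((2 * (n : ℂ) + 1) * (Complex.exp (Complex.I * k * r) *
          ((legendreP n).eval (1 - r ^ 2 / 2) : ℝ)) -
        k * (Complex.exp (Complex.I * k * r) * (Complex.I * r) *
          ((legendreP n).eval (1 - r ^ 2 / 2) : ℝ)))) r := by
    intro r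
    have h1 : HasDerivAt (fun r : ℝ => (r : ℂ)) 1 r := (hasDerivAt_id r).ofReal_comp
    have h2 : HasDerivAt (fun r : ℝ => Complex.exp (Complex.I * k * r))
        (Complex.exp (Complex.I * k * r) * (Complex.I * k * 1)) r := (h1.const_mul _).cexp
    have h3 : HasDerivAt (fun r : ℝ => 1 - r ^ 2 / 2) (-r) r := by
      refine (((hasDerivAt_pow 2 r).div_const 2).const_sub 1).congr_deriv ?_
      norm_num
    have h4 := ((P.hasDerivAt (1 - r ^ 2 / 2)).comp r h3).ofReal_comp
    refine ((h1.mul h2).mul h4).congr_deriv ?_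
    have h5 := congrArg (Polynomial.eval (1 - r ^ 2 / 2)) (succ_mul_legendreP_succ_sub n)
    simp only [Polynomial.eval_mul, Polynomial.eval_C, Polynomial.eval_add, Polynomial.eval_sub,
      Polynomial.eval_X, Polynomial.eval_one] at h5
    have h6 := congrArg Complex.ofReal h5
    simp only [P, Polynomial.derivative_add, Polynomial.eval_add, Function.comp_def]
    push_cast at h6 ⊢
    simp only [Pi.mul_apply]
    linear_combination (-2 * Complex.exp (Complex.I * k * r)) * h6
  have hP1 := continuous_legendreP_radial (n + 1)
  have hP0 := continuous_legendreP_radial n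
  have i1 : IntervalIntegrable (fun r : ℝ => k * (Complex.exp (Complex.I * k * r) *
      (Complex.I * r) * ((legendreP (n + 1)).eval (1 - r ^ 2 / 2) : ℝ))) volume 0 2 :=
    Continuous.intervalIntegrable (by fun_prop) _ _
  have i2 : IntervalIntegrable (fun r : ℝ => (2 * (n : ℂ) + 3) * (Complex.exp (Complex.I * k * r) *
          ((legendreP (n + 1)).eval (1 - r ^ 2 / 2) : ℝ))) volume 0 2 :=
    Continuous.intervalIntegrable (by fun_prop) _ _
  have i3 : IntervalIntegrable (fun r : ℝ => (2 * (n : ℂ) + 1) * (Complex.exp (Complex.I * k * r) *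
          ((legendreP n).eval (1 - r ^ 2 / 2) : ℝ))) volume 0 2 :=
    Continuous.intervalIntegrable (by fun_prop) _ _
  have i4 : IntervalIntegrable (fun r : ℝ => k * (Complex.exp (Complex.I * k * r) *
      (Complex.I * r) * ((legendreP n).eval (1 - r ^ 2 / 2) : ℝ))) volume 0 2 :=
    Continuous.intervalIntegrable (by fun_prop) _ _
  have hftc := intervalIntegral.integral_eq_sub_of_hasDerivAt (a := 0) (b := 2)
    (fun r _ => hderiv r) ((i1.add i2).sub (i3.sub i4))
  rw [intervalIntegral.integral_sub (i1.add i2) (i3.sub i4), intervalIntegral.integral_add i1 i2,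
    intervalIntegral.integral_sub i3 i4] at hftc
  simp only [intervalIntegral.integral_const_mul] at hftc
  -- No boundary terms: at r = 2, t = -1 and P_{n+1} + P_n vanishes; at r = 0 the factor r does.
  have hend : P.eval (1 - (2 : ℝ) ^ 2 / 2) = 0 := by
    rw [show (1 - (2 : ℝ) ^ 2 / 2) = -1 by norm_num]
    simp only [P, Polynomial.eval_add]
    rw [legendreP_eval_of_sq_eq_one _ (by norm_num), legendreP_eval_of_sq_eq_one _ (by norm_num)]
    ring
  rw [hend] at hftc
  simp only [Complex.ofReal_zero, mul_zero, zero_mul, sub_zero] at hftc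
  rw [(hasDerivAt_radialIntegral (n + 1) k).deriv, (hasDerivAt_radialIntegral n k).deriv]
  exact sub_eq_zero.mp hftc

theorem besselA_zero_zero : besselA 0 0 = 1 := by
  have := besselA_zero_add 0
  simpa using this

theorem radialIntegral_zero (k : ℂ) :
    radialIntegral 0 k = 2 * Complex.I * besselA 0 k * besselH 0 k := by
  simp only [radialIntegral, legendreP_zero, Polynomial.eval_one, Complex.ofReal_one, mul_one]
  rw [besselH_zero]
  by_cases hk : k = 0
  · subst hk
    simp [besselA_zero_zero]
    linear_combination 2 * Complex.I_sq
  · have hIk : Complex.I * k ≠ 0 := mul_ne_zero Complex.I_ne_zero hk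
    rw [integral_exp_mul_complex hIk, div_eq_iff hIk]
    have h1 : Complex.exp (Complex.I * k * ((2 : ℝ) : ℂ)) = Complex.exp (k * Complex.I) ^ 2 := by
      rw [← Complex.exp_nat_mul]
      congr 1
      push_cast
      ring
    rw [h1]
    simp only [Complex.ofReal_zero, mul_zero, Complex.exp_zero]
    have h2 := Complex.exp_mul_I k
    have h3 := Complex.sin_sq_add_cos_sq k
    have h4 := mul_besselA_zero k
    rw [h2]
    linear_combination (2 * Complex.I ^ 3 * (Complex.cos k + Complex.sin k * Complex.I)) * h4 + h3 +
      (-(Complex.sin k) ^ 2 + 2 * Complex.I * Complex.sin k * Complex.cos k +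
        2 * Complex.I ^ 2 * (Complex.sin k) ^ 2) * Complex.I_sq

/-- The radial integral is the product of a regular and an outgoing spherical Bessel function. -/
theorem radialIntegral_eq (n : ℕ) :
    radialIntegral n = fun k => 2 * Complex.I * besselA n k * besselH n k := by
  induction n with
  | zero => exact funext radialIntegral_zero
  | succ n ih =>
    have hprod : ∀ n k, HasDerivAt (fun k => 2 * Complex.I * besselA n k * besselH n k)
        (2 * Complex.I * (-k * besselA (n + 1) k) * besselH n k +
          2 * Complex.I * besselA n k * deriv (besselH n) k) k := fun n k =>
      ((hasDerivAt_besselA n k).const_mul _).mul (differentiable_besselH n k).hasDerivAt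
    let D : ℂ → ℂ := fun k => radialIntegral (n + 1) k -
      2 * Complex.I * besselA (n + 1) k * besselH (n + 1) k
    have hDd : ∀ k, HasDerivAt D (deriv (radialIntegral (n + 1)) k -
        (2 * Complex.I * (-k * besselA (n + 2) k) * besselH (n + 1) k +
          2 * Complex.I * besselA (n + 1) k * (k * besselH n k))) k := by
      intro k
      have h := (hasDerivAt_radialIntegral (n + 1) k).differentiableAt.hasDerivAt.sub
        (hprod (n + 1) k)
      rw [(hasDerivAt_besselH_succ n k).deriv] at h
      exact h
    -- The ladder relations give the product of Bessel functions the same recurrence, so the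
    -- difference D satisfies the homogeneous equation.
    have hODE : ∀ k, k * deriv D k + (2 * (n : ℂ) + 3) * D k = 0 := by
      intro k
      have h1 := radialIntegral_recurrence n k
      rw [ih, (hprod n k).deriv] at h1
      have h2 := mul_deriv_besselH n k
      have h3 := besselA_eq n k
      rw [(hDd k).deriv]
      simp only [D]
      linear_combination h1 - 2 * Complex.I * besselA n k * h2 +
        2 * Complex.I * besselH (n + 1) k * h3
    -- k^{2n+3} is the integrating factor: k^{2n+3} D is constant on ℂ and vanishes at 0. The value
    -- D(0) = 0 is then read off the equation itself.
    have hconst : ∀ k, k ^ (2 * n + 3) * D k = 0 := by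
      intro k
      have hd : ∀ w, HasDerivAt (fun w => w ^ (2 * n + 3) * D w) 0 w := by
        intro w
        refine ((hasDerivAt_pow (2 * n + 3) w).mul (hDd w).differentiableAt.hasDerivAt).congr_deriv ?_
        rw [show 2 * n + 3 - 1 = 2 * n + 2 by omega]
        push_cast
        linear_combination w ^ (2 * n + 2) * hODE w
      have h := is_const_of_deriv_eq_zero (fun w => (hd w).differentiableAt)
        (fun w => (hd w).deriv) k 0
      simpa using h
    funext k
    refine sub_eq_zero.mp (?_ : D k = 0)
    by_cases hk : k = 0
    · subst hk
      have h := hODE 0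
      rw [zero_mul, zero_add] at h
      refine (mul_eq_zero.mp h).resolve_left ?_
      exact_mod_cast (by omega : 2 * n + 3 ≠ 0)
    · exact (mul_eq_zero.mp (hconst k)).resolve_left (pow_ne_zero _ hk)

/-- The factor r comes from differentiating e^{ikr} in k, so the integral is I_n - k I_n', to which
the product formula applies. -/
theorem integral_radialKernel (n : ℕ) (k : ℂ) :
    ∫ r in (0 : ℝ)..2, (1 - Complex.I * k * r) * Complex.exp (Complex.I * k * r) *
      ((legendreP n).eval (1 - r ^ 2 / 2) : ℝ) =
      2 * Complex.I * besselA n k * besselH n k -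
        2 * Complex.I * k * (deriv (besselA n) k * besselH n k +
          besselA n k * deriv (besselH n) k) := by
  have hP := continuous_legendreP_radial n
  have h1 : HasDerivAt (fun k => 2 * Complex.I * besselA n k * besselH n k)
      (2 * Complex.I * deriv (besselA n) k * besselH n k +
        2 * Complex.I * besselA n k * deriv (besselH n) k) k :=
    ((differentiable_besselA n k).hasDerivAt.const_mul _).mul
      (differentiable_besselH n k).hasDerivAt
  rw [← radialIntegral_eq] at h1
  have h2 := h1.unique (hasDerivAt_radialIntegral n k)
  have h3 : radialIntegral n k = 2 * Complex.I * besselA n k * besselH n k := by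
    rw [radialIntegral_eq]
  have i1 : IntervalIntegrable (fun r : ℝ => Complex.exp (Complex.I * k * r) *
          ((legendreP n).eval (1 - r ^ 2 / 2) : ℝ)) volume 0 2 :=
    Continuous.intervalIntegrable (by fun_prop) _ _
  have i2 : IntervalIntegrable (fun r : ℝ => k * (Complex.exp (Complex.I * k * r) *
      (Complex.I * r) * ((legendreP n).eval (1 - r ^ 2 / 2) : ℝ))) volume 0 2 :=
    Continuous.intervalIntegrable (by fun_prop) _ _
  calc _ = ∫ r in (0 : ℝ)..2, (Complex.exp (Complex.I * k * r) *
          ((legendreP n).eval (1 - r ^ 2 / 2) : ℝ) - k * (Complex.exp (Complex.I * k * r) *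
      (Complex.I * r) * ((legendreP n).eval (1 - r ^ 2 / 2) : ℝ))) := by
        congr 1; ext r; ring
    _ = _ := by
        rw [intervalIntegral.integral_sub i1 i2, intervalIntegral.integral_const_mul, ← h2,
          ← radialIntegral, h3]
        ring

/-! ### The kernel: zonal form, integrability, principal value -/

/-- The Neumann–Poincaré kernel of the unit ball as a function of the cosine of the angle between
the two points. -/
noncomputable def zonalKernel (k : ℂ) (t : ℝ) : ℂ :=
  1 / (8 * Real.pi) * (1 / (Real.sqrt (2 - 2 * t) : ℂ) - Complex.I * k) *
    Complex.exp (Complex.I * k * (Real.sqrt (2 - 2 * t) : ℂ))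

open scoped RealInnerProductSpace in
theorem UnitSphere.norm_sub_sq (x y : UnitSphere) :
    ‖(x : Space3) - y‖ ^ 2 = 2 - 2 * ⟪(x : Space3), (y : Space3)⟫ := by
  rw [norm_sub_sq_real]
  simp
  ring

open scoped RealInnerProductSpace in
-- Chain rule through r = |x - y|: the directional derivative of r along x is ⟨x - y, x⟩/r = r/2 on
-- the sphere, which lowers the 1/r² singularity of the radial derivative to 1/r.
theorem helmholtzGNormalDeriv_eq_zonalKernel (k : ℂ) {x y : UnitSphere} (hxy : y ≠ x) :
    helmholtzGNormalDeriv k x y = zonalKernel k ⟪(x : Space3), (y : Space3)⟫ := by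
  have hne : (x : Space3) - y ≠ 0 := sub_ne_zero.mpr fun h => hxy (Subtype.ext h.symm)
  have hr : 0 < ‖(x : Space3) - y‖ := norm_pos_iff.mpr hne
  have hsq := UnitSphere.norm_sub_sq x y
  have hsqrt : Real.sqrt (2 - 2 * ⟪(x : Space3), (y : Space3)⟫) = ‖(x : Space3) - y‖ := by
    rw [← hsq, Real.sqrt_sq hr.le]
  have hN : HasFDerivAt (fun z : Space3 => ‖z - (y : Space3)‖)
      ((1 / (2 * ‖(x : Space3) - y‖)) • (2 • (innerSL ℝ ((x : Space3) - y)).comp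
        (ContinuousLinearMap.id ℝ Space3))) (x : Space3) := by
    have h1 := (((hasFDerivAt_id (𝕜 := ℝ) (x : Space3)).sub_const (y : Space3)).norm_sq).sqrt
      (pow_ne_zero 2 hr.ne')
    simpa [Real.sqrt_sq (norm_nonneg _)] using h1
  have hφ : HasDerivAt (fun r : ℝ => -Complex.exp (Complex.I * k * (r : ℂ)) /
      (4 * (Real.pi : ℂ) * (r : ℂ)))
      ((-(Complex.exp (Complex.I * k * (‖(x : Space3) - y‖ : ℂ)) * (Complex.I * k * 1)) *
        (4 * (Real.pi : ℂ) * (‖(x : Space3) - y‖ : ℂ)) -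
        -Complex.exp (Complex.I * k * (‖(x : Space3) - y‖ : ℂ)) * (4 * (Real.pi : ℂ) * 1)) /
        (4 * (Real.pi : ℂ) * (‖(x : Space3) - y‖ : ℂ)) ^ 2) ‖(x : Space3) - y‖ := by
    have h1 : HasDerivAt (fun r : ℝ => (r : ℂ)) 1 ‖(x : Space3) - y‖ :=
      (hasDerivAt_id _).ofReal_comp
    refine ((h1.const_mul (Complex.I * k)).cexp.neg).div (h1.const_mul _) ?_
    have hpi : (Real.pi : ℂ) ≠ 0 := by exact_mod_cast Real.pi_ne_zero
    have hrc : (‖(x : Space3) - y‖ : ℂ) ≠ 0 := by exact_mod_cast hr.ne'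
    exact mul_ne_zero (mul_ne_zero (by norm_num) hpi) hrc
  have h := (hφ.hasFDerivAt.comp (x : Space3) hN).fderiv
  have hinner : ⟪(x : Space3) - y, (x : Space3)⟫ = ‖(x : Space3) - y‖ ^ 2 / 2 := by
    rw [hsq, inner_sub_left, real_inner_self_eq_norm_sq, real_inner_comm]
    simp
    ring
  rw [helmholtzGNormalDeriv]
  have h' : fderiv ℝ (fun z : Space3 => helmholtzG k (z - (y : Space3))) (x : Space3) = _ := h
  rw [h', zonalKernel, hsqrt]
  simp only [ContinuousLinearMap.comp_apply, smul_apply,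
    ContinuousLinearMap.id_apply, innerSL_apply_apply, hinner]
  simp
  have hpi : (Real.pi : ℂ) ≠ 0 := by exact_mod_cast Real.pi_ne_zero
  have hrc : (‖(x : Space3) - y‖ : ℂ) ≠ 0 := by exact_mod_cast hr.ne'
  field_simp
  ring

theorem image_radial_eq : (fun r : ℝ => 1 - r ^ 2 / 2) '' Set.Ioc 0 2 = Set.Ico (-1) 1 := by
  ext t
  simp only [Set.mem_image, Set.mem_Ioc, Set.mem_Ico]
  constructor
  · rintro ⟨r, ⟨h0, h2⟩, rfl⟩
    constructor <;> nlinarith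
  · rintro ⟨h1, h2⟩
    refine ⟨Real.sqrt (2 - 2 * t), ⟨Real.sqrt_pos.mpr (by linarith), ?_⟩, ?_⟩
    · rw [Real.sqrt_le_left (by norm_num)]
      linarith
    · rw [Real.sq_sqrt (by linarith)]
      ring

theorem hasDerivWithinAt_radial (s : Set ℝ) (r : ℝ) :
    HasDerivWithinAt (fun r : ℝ => 1 - r ^ 2 / 2) (-r) s r := by
  refine HasDerivAt.hasDerivWithinAt ?_
  refine (((hasDerivAt_pow 2 r).div_const 2).const_sub 1).congr_deriv ?_
  norm_num

theorem injOn_radial : Set.InjOn (fun r : ℝ => 1 - r ^ 2 / 2) (Set.Ioc 0 2) := by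
  intro a ha b hb h
  have h2 : a ^ 2 = b ^ 2 := by simp only at h; linarith
  exact (pow_left_inj₀ ha.1.le hb.1.le two_ne_zero).mp h2

/-- The Jacobian r cancels the singularity 1/r, leaving a continuous integrand on [0, 2]. -/
theorem abs_smul_zonalKernel_radial (k : ℂ) {r : ℝ} (hr : 0 < r) :
    |-r| • zonalKernel k (1 - r ^ 2 / 2) =
      1 / (8 * Real.pi) * ((1 - Complex.I * k * r) * Complex.exp (Complex.I * k * r)) := by
  have h : Real.sqrt (2 - 2 * (1 - r ^ 2 / 2)) = r := by
    rw [show 2 - 2 * (1 - r ^ 2 / 2) = r ^ 2 by ring, Real.sqrt_sq hr.le]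
  rw [zonalKernel, h, abs_neg, abs_of_pos hr, Complex.real_smul]
  have hrc : (r : ℂ) ≠ 0 := by exact_mod_cast hr.ne'
  have hpi : (Real.pi : ℂ) ≠ 0 := by exact_mod_cast Real.pi_ne_zero
  field_simp

theorem integrableOn_zonalKernel (k : ℂ) : IntegrableOn (zonalKernel k) (Set.Icc (-1) 1) := by
  rw [integrableOn_Icc_iff_integrableOn_Ico, ← image_radial_eq,
    integrableOn_image_iff_integrableOn_abs_deriv_smul measurableSet_Ioc
      (fun r _ => hasDerivWithinAt_radial _ r) injOn_radial]
  have h : IntegrableOn (fun r : ℝ => 1 / (8 * Real.pi) *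
      ((1 - Complex.I * k * r) * Complex.exp (Complex.I * k * r))) (Set.Ioc 0 2) :=
    (Continuous.integrableOn_Icc (by fun_prop)).mono_set Set.Ioc_subset_Icc_self
  exact h.congr_fun (fun r hr => (abs_smul_zonalKernel_radial k hr.1).symm) measurableSet_Ioc

theorem integral_zonalKernel_mul_legendreP (k : ℂ) (n : ℕ) :
    2 * Real.pi * ∫ t in Set.Icc (-1 : ℝ) 1, zonalKernel k t * ((legendreP n).eval t : ℝ) =
      Complex.I / 2 * (besselA n k * besselH n k -
        k * (deriv (besselA n) k * besselH n k + besselA n k * deriv (besselH n) k)) := by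
  rw [integral_Icc_eq_integral_Ico, ← image_radial_eq,
    integral_image_eq_integral_abs_deriv_smul measurableSet_Ioc
      (fun r _ => hasDerivWithinAt_radial _ r) injOn_radial]
  have h : ∫ r in Set.Ioc (0 : ℝ) 2, |-r| • (zonalKernel k (1 - r ^ 2 / 2) *
        ((legendreP n).eval (1 - r ^ 2 / 2) : ℝ)) =
      ∫ r in Set.Ioc (0 : ℝ) 2, 1 / (8 * (Real.pi : ℂ)) * ((1 - Complex.I * k * r) *
        Complex.exp (Complex.I * k * r) * ((legendreP n).eval (1 - r ^ 2 / 2) : ℝ)) := by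
    refine setIntegral_congr_fun measurableSet_Ioc fun r hr => ?_
    rw [← smul_mul_assoc, abs_smul_zonalKernel_radial k hr.1]
    ring
  rw [h, integral_const_mul, ← intervalIntegral.integral_of_le (by norm_num),
    integral_radialKernel]
  have hpi : (Real.pi : ℂ) ≠ 0 := by exact_mod_cast Real.pi_ne_zero
  field_simp
  ring

open scoped RealInnerProductSpace in
/-- The principal value exists as an absolutely convergent integral of the weakly singular
kernel. -/
theorem hasNPValue_of_continuous (k : ℂ) {f : UnitSphere → ℂ} (hf : Continuous f)
    (x : UnitSphere) :
    HasNPValue k f x (∫ y : UnitSphere, zonalKernel k ⟪(x : Space3), (y : Space3)⟫ * f y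
      ∂(volume : Measure Space3).toSphere) := by
  have hK : Integrable (fun y : UnitSphere => zonalKernel k ⟪(x : Space3), (y : Space3)⟫ * f y)
      (volume : Measure Space3).toSphere :=
    (integrable_comp_inner_toSphere (integrableOn_zonalKernel k) x).mul_continuous_of_compact hf
  have hopen : ∀ ε, MeasurableSet (awayFrom x ε) := fun ε =>
    (isOpen_lt continuous_const (continuous_id.dist continuous_const)).measurableSet
  have heq : ∀ ε : ℝ, 0 < ε → Set.EqOn
      (fun y : UnitSphere => zonalKernel k ⟪(x : Space3), (y : Space3)⟫ * f y)
      (fun y => helmholtzGNormalDeriv k x y * f y) (awayFrom x ε) := by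
    intro ε hε y hy
    have hyx : y ≠ x := dist_pos.mp (hε.trans hy)
    simp only [helmholtzGNormalDeriv_eq_zonalKernel k hyx]
  refine ⟨fun ε hε => hK.integrableOn.congr_fun (heq ε hε) (hopen ε), ?_⟩
  have hlim : Tendsto (fun ε : ℝ => ∫ y : UnitSphere, (awayFrom x ε).indicator
      (fun y : UnitSphere => zonalKernel k ⟪(x : Space3), (y : Space3)⟫ * f y) y
      ∂(volume : Measure Space3).toSphere) (𝓝[>] 0)
      (𝓝 (∫ y : UnitSphere, zonalKernel k ⟪(x : Space3), (y : Space3)⟫ * f y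
        ∂(volume : Measure Space3).toSphere)) := by
    -- The full integrand dominates its truncations, and every y ≠ x lies in the truncated domain
    -- once ε < |x - y|.
    refine tendsto_integral_filter_of_dominated_convergence
      (fun y : UnitSphere => ‖zonalKernel k ⟪(x : Space3), (y : Space3)⟫ * f y‖)
      (.of_forall fun ε => hK.aestronglyMeasurable.indicator (hopen ε))
      (.of_forall fun ε => .of_forall fun y => norm_indicator_le_norm_self _ _) hK.norm ?_
    filter_upwards [ae_inner_ne_one x] with y hy
    have hyx : y ≠ x := by
      rintro rfl
      apply hy
      rw [real_inner_self_eq_norm_sq]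
      simp
    refine tendsto_const_nhds.congr' ?_
    have hd : Set.Iio (dist y x) ∈ 𝓝[>] (0 : ℝ) :=
      mem_nhdsWithin_of_mem_nhds (Iio_mem_nhds (dist_pos.mpr hyx))
    filter_upwards [hd] with ε hε
    have hmem : y ∈ awayFrom x ε := hε
    rw [Set.indicator_of_mem hmem]
  refine hlim.congr' ?_
  filter_upwards [self_mem_nhdsWithin] with ε hε
  rw [integral_indicator (hopen ε), npTruncated]
  exact setIntegral_congr_fun (hopen ε) (heq ε hε)

/-! ### The eigenvalue in its two forms -/

theorem hasNPValue_sphericalHarmonicY (k : ℂ) (n : ℕ) (m : ℤ) (hm : |m| ≤ (n : ℤ))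
    (x : UnitSphere) :
    HasNPValue k (sphericalHarmonicY n m) x
      (Complex.I / 2 * (besselA n k * besselH n k -
        k * (deriv (besselA n) k * besselH n k + besselA n k * deriv (besselH n) k)) *
        sphericalHarmonicY n m x) := by
  have h := hasNPValue_of_continuous k (continuous_sphericalHarmonicY n m) x
  rwa [funkHecke_sphericalHarmonicY (integrableOn_zonalKernel k) n m hm,
    integral_zonalKernel_mul_legendreP] at h

theorem HasNPValue.neumannPoincare_eq {k : ℂ} {f : UnitSphere → ℂ} {x : UnitSphere} {v : ℂ}
    (h : HasNPValue k f x v) : neumannPoincare k f x = v :=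
  h.2.limUnder_eq

theorem lemma2p3 (k : ℂ) (hk : k ≠ 0) (n : ℕ) (m : ℤ) (hm : |m| ≤ (n : ℤ)) :
    (∀ x : UnitSphere, HasNPValue k (sphericalHarmonicY n m) x
      (neumannPoincare k (sphericalHarmonicY n m) x)) ∧
    neumannPoincare k (sphericalHarmonicY n m) =
      (-1 / 2 - Complex.I * k ^ 2 * sphericalBesselJ n k * deriv (sphericalHankelH1 n) k) •
        sphericalHarmonicY n m ∧
    neumannPoincare k (sphericalHarmonicY n m) =
      (1 / 2 - Complex.I * k ^ 2 * deriv (sphericalBesselJ n) k * sphericalHankelH1 n k) •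
        sphericalHarmonicY n m := by
  have h := hasNPValue_sphericalHarmonicY k n m hm
  have h1 := sq_mul_sphericalBesselJ_mul_deriv n hk
  have h2 := sq_mul_deriv_sphericalBesselJ_mul n hk
  have hW := besselA_mul_besselH_succ_sub n k
  have hH := mul_deriv_besselH n k
  have hA := (hasDerivAt_besselA n k).deriv
  refine ⟨fun x => by rw [(h x).neumannPoincare_eq]; exact h x, ?_, ?_⟩
  · funext x
    rw [(h x).neumannPoincare_eq, Pi.smul_apply, smul_eq_mul]
    congr 1
    rw [hA]
    -- The scalar is -(i/2)k²(j_n h_n' + j_n' h_n); the Wronskian trades j_n' h_n for j_n h_n' at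
    -- the cost of -1/2. The other form uses the opposite exchange.
    linear_combination Complex.I * h1 - Complex.I / 2 * hW +
      Complex.I / 2 * besselA n k * hH + Complex.I_sq / 2
  · funext x
    rw [(h x).neumannPoincare_eq, Pi.smul_apply, smul_eq_mul]
    congr 1
    rw [hA] at h2 ⊢
    linear_combination Complex.I * h2 + Complex.I / 2 * hW -
      Complex.I / 2 * besselA n k * hH - Complex.I_sq / 2
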